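/- Consider continual learning of $T$ linear regression tasks. Task $k$ has an optimal model $w_k^*\in\mathbb{R}^p$ and $n\ge 1$ training samples: a feature matrix $X_k\in\mathbb{R}^{p\times n}$, whose columns are the feature vectors, and labels $y_k=X_k^\top w_k^*+z_k$. All entries of all $X_k$ are $\mathcal N(0,1)$, all entries of all noise vectors $z_k\in\mathbb{R}^n$ are $\mathcal N(0,\sigma^2)$ with $\sigma\ge 0$, and all of these are mutually independent. When the tasks are learnt in the order $\pi(1),\dots,\pi(T)$ ($\pi$ a permutation of $\{1,\dots,T\}$), training starts at $w_0=0$, and $w_t$ is the solution of $\min_w\|w-w_{t-1}\|_2$ subject to $X_{\pi(t)}^\top w=y_{\pi(t)}$ (which exists and is unique almost surely when $n\le p$). The forgetting of the order $\pi$ is $$F_T=\frac1{T-1}\sum_{i=1}^{T-1}\Big(\|w_T-w_{\pi(i)}^*\|_2^2-\|w_i-w_{\pi(i)}^*\|_2^2\Big).$$ Suppose that the tasks form two categories $C_1,C_2$ with equally many tasks, that all tasks in the same category have the same optimal model, and that the optimal models of the two categories are different but have the same Euclidean norm. Suppose $p\ge n+2$ and $T\in\{4,6\}$. Then $F_T$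 is integrable for every order, and an order minimizes the expected forgetting $\mathbb{E}[F_T]$ among all orders of the tasks if and only if it is perfectly alternating, i.e. the categories of the successive tasks are $(C_i,C_j,C_i,C_j)$ for $T=4$ and $(C_i,C_j,C_i,C_j,C_i,C_j)$ for $T=6$, where $\{i,j\}=\{1,2\}$. -/

import Mathlib

open MeasureTheory ProbabilityTheory
open scoped Matrix NNReal

namespace ContinualLearning

/-- The parameter space `ℝ^p` with the Euclidean norm. -/
abbrev Param (p : ℕ) := EuclideanSpace ℝ (Fin p)

/-- Noisy linear labels `y = Xᵀ w* + z`; the columns of `X` are the feature vectors of the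
`n` training samples. -/
def labels {n p : ℕ} (X : Matrix (Fin p) (Fin n) ℝ) (wstar : Param p) (z : Fin n → ℝ) :
    Fin n → ℝ :=
  Xᵀ *ᵥ wstar.ofLp + z

/-- `v` solves `min ‖v - w‖` subject to `Xᵀ v = y`: it fits the training data exactly and, among
all parameters that do, has the smallest change from `w`. -/
def IsMinChange {n p : ℕ} (X : Matrix (Fin p) (Fin n) ℝ) (y : Fin n → ℝ) (w v : Param p) : Prop :=
  Xᵀ *ᵥ v.ofLp = y ∧ ∀ u : Param p, Xᵀ *ᵥ u.ofLp = y → ‖v - w‖ ≤ ‖u - w‖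

open Classical in
/-- Training on `(X, y)` from the initial point `w`: the (unique) solution of the minimal-change
interpolation problem. If the data cannot be interpolated, the parameters are left unchanged; with
Gaussian data and `n ≤ p` this happens with probability zero. -/
noncomputable def train {n p : ℕ} (X : Matrix (Fin p) (Fin n) ℝ) (y : Fin n → ℝ) (w : Param p) :
    Param p :=
  if h : ∃ v, IsMinChange X y w v then h.choose else w

/-- The parameters after the first `t` tasks of a sequence of `T` tasks, starting from `w₀ = 0`.
Positions in the sequence are numbered from `0`, so the task at position `i : Fin T` is the
`(i + 1)`-st one, and training on it turns `trained X y i` into `trained X y (i + 1)`. -/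
noncomputable def trained {T n p : ℕ} (X : Fin T → Matrix (Fin p) (Fin n) ℝ)
    (y : Fin T → Fin n → ℝ) : ℕ → Param p
  | 0 => 0
  | t + 1 => if h : t < T then train (X ⟨t, h⟩) (y ⟨t, h⟩) (trained X y t) else trained X y t

/-- The model error `‖w - w*‖²`. -/
noncomputable def modelError {p : ℕ} (wstar w : Param p) : ℝ := ‖w - wstar‖ ^ 2

/-- The forgetting `F_T = (1 / (T - 1)) ∑_{i < T} (L_i(w_T) - L_i(w_i))` of the task sequence with
optimal models `wstar`, features `X` and noise `z`, learnt in the order of the indices. -/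
noncomputable def forgetting {T n p : ℕ} (wstar : Fin T → Param p)
    (X : Fin T → Matrix (Fin p) (Fin n) ℝ) (z : Fin T → Fin n → ℝ) : ℝ :=
  let w := trained X (fun i => labels (X i) (wstar i) (z i))
  1 / ((T : ℝ) - 1) * ∑ i ∈ Finset.univ.filter (fun i : Fin T => (i : ℕ) + 1 < T),
    (modelError (wstar i) (w T) - modelError (wstar i) (w ((i : ℕ) + 1)))

/-- The forgetting when the tasks are learnt in the order `π 0, π 1, …, π (T - 1)`. -/
noncomputable def forgettingInOrder {T n p : ℕ} (π : Equiv.Perm (Fin T)) (wstar : Fin T → Param p)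
    (X : Fin T → Matrix (Fin p) (Fin n) ℝ) (z : Fin T → Fin n → ℝ) : ℝ :=
  forgetting (fun t => wstar (π t)) (fun t => X (π t)) (fun t => z (π t))

/-- Gaussian data: all entries of all feature matrices are standard Gaussian, all entries of all
noise vectors are `N(0, σ²)`, and all these random variables are mutually independent. -/
structure IsGaussianData {Ω : Type*} [MeasurableSpace Ω] (μ : Measure Ω) {T n p : ℕ} (σ : ℝ≥0)
    (X : Fin T → Ω → Matrix (Fin p) (Fin n) ℝ) (z : Fin T → Ω → Fin n → ℝ) : Prop where
  feature_law : ∀ k a b, HasLaw (fun ω => X k ω a b) (gaussianReal 0 1) μ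
  noise_law : ∀ k b, HasLaw (fun ω => z k ω b) (gaussianReal 0 (σ ^ 2)) μ
  indep : iIndepFun
    (Sum.elim (fun (q : Fin T × Fin p × Fin n) (ω : Ω) => X q.1 ω q.2.1 q.2.2)
      (fun (q : Fin T × Fin n) (ω : Ω) => z q.1 ω q.2)) μ

/-- A sequence of category labels of the form `(i, j, i, j, …)` with `i ≠ j`. -/
def IsAlternating {T : ℕ} (c : Fin T → Fin 2) : Prop :=
  ∃ i j : Fin 2, i ≠ j ∧ ∀ t : Fin T, c t = if Even (t : ℕ) then i else j

end ContinualLearning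

namespace ContinualLearning

/-! Write `P` for the orthogonal projection onto the column space of a feature matrix `X`, and `X⁺ =
X (Xᵀ X)⁻¹`. Almost surely the Gram matrix is invertible, and a training step sends `w - v` to `(1 -
P)(w - v) + P(w* - v) + X⁺ z` for any reference model `v` (`train_eq_step`,
`step_sub_dotProduct_self`). Rotation invariance and `tr P = n` give `E P = (n/p) I`, while the
symmetry `X ↦ -X` kills the mean of the noise cross term. As the data of a task are independent of
the earlier iterates, the mean squared error satisfies, with `r = 1 - n/p`, the recursion `E_{t+1} =
r E_t + (1 - r) ‖w* - v‖² + N` (`modelAfter_sq_succ`), solved by `expectedError`.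

The constant `N` is finite because `p ≥ n + 2`: a column of `X` has at least three Gaussian
coordinates orthogonal to the other columns, and the inverse squared norm of a three-dimensional
Gaussian vector is integrable (`integrable_gram_inv_apply_self`).

In the expected forgetting the noise terms do not depend on the order; nor do the terms from the
start `0`, since the norms agree; nor do the final errors, since every task has equally many tasks
of the other category. What remains is `A - B * discrepancy r c` with `B > 0`
(`exists_expectedForgetting_eq`), where pairs of different categories at distance `d` weigh `r ^ d`.
Minimal forgetting thus means maximal discrepancy, and for lengths 4 and 6 a finite comparison shows
that exactly the alternating words maximize it (`discrepancy_four`, `discrepancy_six`). -/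

/-- The right inverse `X (Xᵀ X)⁻¹` of `Xᵀ`; it is `0` if `Xᵀ X` is singular. -/
noncomputable def pinv {n p : ℕ} (X : Matrix (Fin p) (Fin n) ℝ) : Matrix (Fin p) (Fin n) ℝ :=
  X * (Xᵀ * X)⁻¹

/-- The orthogonal projection onto the column space of `X`, if `Xᵀ X` is invertible, and `0`
otherwise. -/
noncomputable def proj {n p : ℕ} (X : Matrix (Fin p) (Fin n) ℝ) : Matrix (Fin p) (Fin p) ℝ :=
  pinv X * Xᵀ

lemma dotProduct_self_nonneg {ι : Type*} [Fintype ι] (v : ι → ℝ) : 0 ≤ v ⬝ᵥ v :=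
  Finset.sum_nonneg fun _ _ => mul_self_nonneg _

/-! ### Algebra of the projection and of a single training step -/

section Algebra

variable {n p : ℕ} (X : Matrix (Fin p) (Fin n) ℝ)

lemma gram_inv_transpose : ((Xᵀ * X)⁻¹)ᵀ = (Xᵀ * X)⁻¹ := by
  rw [Matrix.transpose_nonsing_inv, Matrix.transpose_mul, Matrix.transpose_transpose]

/-- A singular Gram matrix has inverse `0` by convention, so both sides vanish. This is why symmetry
and idempotence of `proj` hold for every `X`, not only almost surely. -/
lemma gram_inv_mul_gram_mul_gram_inv : (Xᵀ * X)⁻¹ * ((Xᵀ * X) * (Xᵀ * X)⁻¹) = (Xᵀ * X)⁻¹ := by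
  by_cases h : IsUnit (Xᵀ * X).det
  · rw [Matrix.mul_nonsing_inv _ h, mul_one]
  · simp [Matrix.nonsing_inv_apply_not_isUnit _ h]

lemma transpose_pinv : (pinv X)ᵀ = (Xᵀ * X)⁻¹ * Xᵀ := by
  rw [pinv, Matrix.transpose_mul, gram_inv_transpose]

lemma transpose_pinv_mul_pinv : (pinv X)ᵀ * pinv X = (Xᵀ * X)⁻¹ := by
  rw [transpose_pinv, pinv, Matrix.mul_assoc, ← Matrix.mul_assoc Xᵀ X,
    gram_inv_mul_gram_mul_gram_inv]

lemma proj_eq : proj X = X * ((Xᵀ * X)⁻¹ * Xᵀ) := by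
  rw [proj, pinv, Matrix.mul_assoc]

lemma transpose_proj : (proj X)ᵀ = proj X := by
  rw [proj, Matrix.transpose_mul, Matrix.transpose_transpose, transpose_pinv, pinv,
    Matrix.mul_assoc]

lemma proj_mul_pinv : proj X * pinv X = pinv X := by
  rw [proj_eq, pinv, Matrix.mul_assoc, Matrix.mul_assoc, ← Matrix.mul_assoc Xᵀ X,
    gram_inv_mul_gram_mul_gram_inv]

lemma proj_mul_proj : proj X * proj X = proj X := by
  have h : proj X * proj X = (proj X * pinv X) * Xᵀ := by rw [Matrix.mul_assoc]; rfl
  rw [h, proj_mul_pinv]; rfl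

lemma transpose_mul_pinv (h : (Xᵀ * X).det ≠ 0) : Xᵀ * pinv X = 1 := by
  rw [pinv, ← Matrix.mul_assoc, Matrix.mul_nonsing_inv _ h.isUnit]

lemma trace_proj (h : (Xᵀ * X).det ≠ 0) : (proj X).trace = n := by
  rw [proj, Matrix.trace_mul_comm, transpose_mul_pinv X h]; simp

lemma pinv_neg : pinv (-X) = -pinv X := by
  simp [pinv]

lemma proj_mul_orthogonal (U : Matrix (Fin p) (Fin p) ℝ) (hU : Uᵀ * U = 1) :
    proj (U * X) = U * proj X * Uᵀ := by
  have : (U * X)ᵀ * (U * X) = Xᵀ * X := by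
    rw [Matrix.transpose_mul, Matrix.mul_assoc, ← Matrix.mul_assoc Uᵀ, hU, Matrix.one_mul]
  rw [proj, pinv, this, proj, pinv, Matrix.transpose_mul]
  simp only [Matrix.mul_assoc]

lemma dotProduct_mulVec_comm_proj (v w : Fin p → ℝ) : v ⬝ᵥ proj X *ᵥ w = (proj X *ᵥ v) ⬝ᵥ w := by
  rw [Matrix.dotProduct_mulVec, ← Matrix.mulVec_transpose, transpose_proj]

lemma dotProduct_proj_mulVec_comm (v w : Fin p → ℝ) : v ⬝ᵥ proj X *ᵥ w = w ⬝ᵥ proj X *ᵥ v := by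
  rw [dotProduct_mulVec_comm_proj, dotProduct_comm]

lemma proj_mulVec_dotProduct_self (v : Fin p → ℝ) :
    (proj X *ᵥ v) ⬝ᵥ (proj X *ᵥ v) = v ⬝ᵥ proj X *ᵥ v := by
  rw [← dotProduct_mulVec_comm_proj, Matrix.mulVec_mulVec, proj_mul_proj]

lemma dotProduct_proj_mulVec_le (v : Fin p → ℝ) : v ⬝ᵥ proj X *ᵥ v ≤ v ⬝ᵥ v := by
  have h := dotProduct_self_nonneg (v - proj X *ᵥ v)
  rw [sub_dotProduct, dotProduct_sub, dotProduct_sub, proj_mulVec_dotProduct_self,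
    ← dotProduct_mulVec_comm_proj] at h
  linarith

/-- A symmetric idempotent satisfies `P a a = ∑ c, P a c ^ 2`. Hence `P a a ^ 2 ≤ P a a`, so `P a a
≤ 1`, which bounds the whole row. The bound makes all entries of `proj` integrable. -/
lemma abs_proj_apply_le (a b : Fin p) : |proj X a b| ≤ 1 := by
  have key : ∀ a b, (proj X a b) ^ 2 ≤ proj X a a := by
    intro a b
    have h : proj X a a = ∑ c, proj X a c * proj X a c := by
      conv_lhs => rw [← proj_mul_proj]
      rw [Matrix.mul_apply]
      refine Finset.sum_congr rfl fun c _ => ?_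
      rw [← Matrix.transpose_apply (proj X) a c, transpose_proj]
    rw [h, pow_two]
    exact Finset.single_le_sum (f := fun c => proj X a c * proj X a c)
      (fun c _ => mul_self_nonneg _) (Finset.mem_univ b)
  have h1 := key a a
  have h2 := key a b
  rw [← sq_le_one_iff_abs_le_one]
  nlinarith

lemma pinv_mulVec_dotProduct_self (z : Fin n → ℝ) :
    (pinv X *ᵥ z) ⬝ᵥ (pinv X *ᵥ z) = z ⬝ᵥ (Xᵀ * X)⁻¹ *ᵥ z := by
  rw [← transpose_pinv_mul_pinv, ← Matrix.mulVec_mulVec, Matrix.dotProduct_mulVec z,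
    ← Matrix.mulVec_transpose, Matrix.transpose_transpose]

/-- One training step from the parameters `w`, in closed form. -/
noncomputable def step (y : Fin n → ℝ) (w : Fin p → ℝ) : Fin p → ℝ :=
  w + pinv X *ᵥ (y - Xᵀ *ᵥ w)

/-- The part `(1 - P)(w - v)` is orthogonal to `P(w* - v) + X⁺ z`, so no cross term involving `w`
survives; `P X⁺ = X⁺` simplifies the noise cross term. -/
lemma step_sub_dotProduct_self (z : Fin n → ℝ) (wstar w v : Fin p → ℝ) :
    (step X (Xᵀ *ᵥ wstar + z) w - v) ⬝ᵥ (step X (Xᵀ *ᵥ wstar + z) w - v) =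
      (w - v) ⬝ᵥ (w - v) - (w - v) ⬝ᵥ proj X *ᵥ (w - v)
        + (wstar - v) ⬝ᵥ proj X *ᵥ (wstar - v)
        + (pinv X *ᵥ z) ⬝ᵥ (pinv X *ᵥ z) + 2 * ((wstar - v) ⬝ᵥ pinv X *ᵥ z) := by
  obtain ⟨a, rfl⟩ : ∃ a, w = v + a := ⟨w - v, by abel⟩
  obtain ⟨b, rfl⟩ : ∃ b, wstar = v + b := ⟨wstar - v, by abel⟩
  have h : step X (Xᵀ *ᵥ (v + b) + z) (v + a) - v
      = (a - proj X *ᵥ a) + (proj X *ᵥ b + pinv X *ᵥ z) := by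
    have : Xᵀ *ᵥ (v + b) + z - Xᵀ *ᵥ (v + a) = Xᵀ *ᵥ b - Xᵀ *ᵥ a + z := by
      simp only [Matrix.mulVec_add]; abel
    rw [step, this, Matrix.mulVec_add, Matrix.mulVec_sub, Matrix.mulVec_mulVec,
      Matrix.mulVec_mulVec, ← proj]
    abel
  have hz : ∀ v, (proj X *ᵥ v) ⬝ᵥ (pinv X *ᵥ z) = v ⬝ᵥ pinv X *ᵥ z := by
    intro v
    rw [← dotProduct_mulVec_comm_proj, Matrix.mulVec_mulVec, proj_mul_pinv]
  have hab : ∀ v w, (proj X *ᵥ v) ⬝ᵥ (proj X *ᵥ w) = v ⬝ᵥ proj X *ᵥ w := by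
    intro v w
    rw [← dotProduct_mulVec_comm_proj, Matrix.mulVec_mulVec, proj_mul_proj]
  rw [h, add_sub_cancel_left, add_sub_cancel_left]
  simp only [add_dotProduct, dotProduct_add, sub_dotProduct, dotProduct_sub, hz, hab,
    dotProduct_comm (pinv X *ᵥ z) (proj X *ᵥ b), dotProduct_comm (pinv X *ᵥ z) (proj X *ᵥ a),
    dotProduct_comm (proj X *ᵥ b) (a), dotProduct_comm (pinv X *ᵥ z) a,
    dotProduct_comm (proj X *ᵥ a) a, dotProduct_proj_mulVec_comm X b a]
  ring

end Algebra

lemma norm_sq_eq_dotProduct {p : ℕ} (v : Param p) : ‖v‖ ^ 2 = v.ofLp ⬝ᵥ v.ofLp := by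
  rw [EuclideanSpace.real_norm_sq_eq]
  simp [dotProduct, pow_two]

/-- The step `s` is feasible and `s - w` lies in the column space of `X`, whereas `u - s` lies in
the kernel of `Xᵀ` for any feasible `u`. Pythagoras then makes `s` the unique minimizer, so the
chosen solution must be `s`. -/
lemma train_eq_step {n p : ℕ} (X : Matrix (Fin p) (Fin n) ℝ) (h : (Xᵀ * X).det ≠ 0)
    (y : Fin n → ℝ) (w : Param p) : train X y w = WithLp.toLp 2 (step X y w.ofLp) := by
  set s : Param p := WithLp.toLp 2 (step X y w.ofLp) with hs
  have hfeas : Xᵀ *ᵥ s.ofLp = y := by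
    simp only [hs, step, Matrix.mulVec_add, Matrix.mulVec_mulVec, transpose_mul_pinv X h,
      Matrix.one_mulVec]
    abel
  have key : ∀ u : Param p, Xᵀ *ᵥ u.ofLp = y → ‖u - w‖ ^ 2 = ‖s - w‖ ^ 2 + ‖u - s‖ ^ 2 := by
    intro u hu
    obtain ⟨c, hc⟩ : ∃ c, (s - w).ofLp = X *ᵥ c :=
      ⟨(Xᵀ * X)⁻¹ *ᵥ (y - Xᵀ *ᵥ w.ofLp), by simp [hs, step, pinv, Matrix.mulVec_mulVec]⟩
    have h0 : Xᵀ *ᵥ (u - s).ofLp = 0 := by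
      rw [WithLp.ofLp_sub, Matrix.mulVec_sub, hu, hfeas, sub_self]
    have horth : (u - s).ofLp ⬝ᵥ (s - w).ofLp = 0 := by
      rw [hc, Matrix.dotProduct_mulVec, ← Matrix.mulVec_transpose, h0, zero_dotProduct]
    have hsum : u - w = (s - w) + (u - s) := by abel
    rw [hsum, norm_sq_eq_dotProduct, norm_sq_eq_dotProduct, norm_sq_eq_dotProduct, WithLp.ofLp_add,
      add_dotProduct, dotProduct_add, dotProduct_add, horth, dotProduct_comm (s - w).ofLp (u - s).ofLp,
      horth]
    ring
  have hmin : IsMinChange X y w s := by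
    refine ⟨hfeas, fun u hu => ?_⟩
    have := key u hu
    exact le_of_sq_le_sq (by nlinarith [sq_nonneg ‖u - s‖]) (norm_nonneg _)
  have hex : ∃ v, IsMinChange X y w v := ⟨s, hmin⟩
  rw [train, dif_pos hex]
  obtain ⟨hv, hle⟩ := hex.choose_spec
  have h1 := key _ hv
  have h2 := hle s hfeas
  have h3 : ‖hex.choose - s‖ ^ 2 ≤ 0 := by
    nlinarith [norm_nonneg (hex.choose - w), norm_nonneg (s - w)]
  have h4 : ‖hex.choose - s‖ = 0 := by
    have := sq_nonneg ‖hex.choose - s‖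
    exact pow_eq_zero_iff (two_ne_zero) |>.1 (le_antisymm h3 this)
  exact sub_eq_zero.1 (norm_eq_zero.1 h4)

/-! ### Gaussian vectors: orthonormal coordinates and inverse moments -/

section Gaussian

/-- The standard Gaussian measure on `Fin p → ℝ`. -/
noncomputable abbrev gaussianVec (p : ℕ) : Measure (Fin p → ℝ) :=
  Measure.pi fun _ => gaussianReal 0 1

/-- The characteristic function of the standard Gaussian depends only on the norm of its argument,
and `t ↦ ∑ i, t i • e i` preserves norms. -/
lemma map_inner_gaussianVec {m p : ℕ} (e : Fin m → Param p) (he : Orthonormal ℝ e) :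
    (gaussianVec p).map (fun x i => (e i).ofLp ⬝ᵥ x) = gaussianVec m := by
  set L : Param p → Param m := fun x => WithLp.toLp 2 fun i => inner ℝ (e i) x with hL
  have hLm : Measurable L := by
    refine (WithLp.measurable_toLp 2 _).comp (measurable_pi_lambda _ fun i => ?_)
    fun_prop
  have hstd : (stdGaussian (Param p)).map L = stdGaussian (Param m) := by
    have : IsProbabilityMeasure ((stdGaussian (Param p)).map L) :=
      Measure.isProbabilityMeasure_map hLm.aemeasurable
    apply Measure.ext_of_charFun
    ext t
    have hin : ∀ x, inner ℝ (L x) t = inner ℝ x (∑ i, t i • e i) := by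
      intro x
      rw [inner_sum, PiLp.inner_apply]
      refine Finset.sum_congr rfl fun i _ => ?_
      rw [inner_smul_right, real_inner_comm (e i) x]
      simp [hL]
    have hnorm : ‖∑ i, t i • e i‖ = ‖t‖ := by
      rw [← sq_eq_sq₀ (norm_nonneg _) (norm_nonneg _), ← real_inner_self_eq_norm_sq, he.inner_sum,
        EuclideanSpace.real_norm_sq_eq]
      simp [pow_two]
    rw [charFun_apply, integral_map hLm.aemeasurable (by fun_prop)]
    simp_rw [hin]
    rw [← charFun_apply, charFun_stdGaussian, charFun_stdGaussian, hnorm]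
  rw [← map_pi_eq_stdGaussian, ← map_pi_eq_stdGaussian,
    Measure.map_map hLm (WithLp.measurable_toLp 2 _)] at hstd
  have := congrArg (Measure.map (WithLp.ofLp (p := 2))) hstd
  rw [Measure.map_map (WithLp.measurable_ofLp 2 _) (hLm.comp (WithLp.measurable_toLp 2 _)),
    Measure.map_map (WithLp.measurable_ofLp 2 _) (WithLp.measurable_toLp 2 _)] at this
  convert this using 1
  · congr 1
    ext x i
    simp [hL, PiLp.inner_apply, dotProduct, mul_comm]
  · symm; exact Measure.map_id

lemma measurePreserving_inner_gaussianVec {m p : ℕ} (e : Fin m → Param p)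
    (he : Orthonormal ℝ e) :
    MeasurePreserving (fun x i => (e i).ofLp ⬝ᵥ x) (gaussianVec p) (gaussianVec m) := by
  refine ⟨measurable_pi_lambda _ fun i => ?_, map_inner_gaussianVec e he⟩
  unfold dotProduct
  fun_prop

lemma integrable_abs_rpow_gaussianReal {s : ℝ} (hs : -1 < s) :
    Integrable (fun t : ℝ => |t| ^ s) (gaussianReal 0 1) := by
  have h0 : IntegrableOn (fun t : ℝ => |t| ^ s * Real.exp (-(1 / 2) * t ^ 2)) (Set.Ioi 0) := by
    refine (integrableOn_rpow_mul_exp_neg_mul_sq (b := 1 / 2) (by norm_num) hs).congr_fun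
      (fun t ht => ?_) measurableSet_Ioi
    simp only [abs_of_pos (show (0 : ℝ) < t from ht)]
  have h1 : IntegrableOn (fun t : ℝ => |t| ^ s * Real.exp (-(1 / 2) * t ^ 2)) (Set.Iic 0) := by
    have := (integrableOn_Ici_iff_integrableOn_Ioi (by simp) |>.2 h0).comp_neg
    simpa using this
  have h2 : Integrable (fun t : ℝ => |t| ^ s * Real.exp (-(1 / 2) * t ^ 2)) := by
    rw [← integrableOn_univ, ← Set.Iic_union_Ioi (a := (0 : ℝ))]
    exact h1.union h0
  rw [gaussianReal_of_var_ne_zero 0 one_ne_zero, integrable_withDensity_iff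
    (measurable_gaussianPDF 0 1) (Filter.Eventually.of_forall fun _ => gaussianPDF_lt_top)]
  refine (h2.const_mul (Real.sqrt (2 * Real.pi))⁻¹).congr (Filter.Eventually.of_forall fun t => ?_)
  simp only [toReal_gaussianPDF, gaussianPDFReal]
  rw [show -(t - 0) ^ 2 / (2 * ((1 : ℝ≥0) : ℝ)) = -(1 / 2) * t ^ 2 by push_cast; ring]
  push_cast
  rw [mul_one]
  ring

lemma ae_gaussianVec_ne_zero {m : ℕ} (i : Fin m) : ∀ᵐ y ∂gaussianVec m, y i ≠ 0 := by
  have : NullSingletonClass (gaussianReal 0 1) := nullSingletonClass_gaussianReal one_ne_zero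
  have h : ∀ᵐ t ∂gaussianReal 0 1, t ≠ 0 := by
    rw [ae_iff]; simp
  exact (Measure.quasiMeasurePreserving_eval (μ := fun _ : Fin m => gaussianReal 0 1) i).ae h

/-- By AM-GM the inverse squared norm is at most `∏ |y i| ^ (-2/3)`. This product of functions of
independent coordinates is integrable, each exponent being above `-1`; with two coordinates the
exponent would be the non-integrable `-1`. -/
lemma integrable_inv_norm_sq_gaussianVec_three :
    Integrable (fun y : Fin 3 → ℝ => (y ⬝ᵥ y)⁻¹) (gaussianVec 3) := by
  have h := Integrable.fintype_prod (ι := Fin 3) (μ := fun _ => gaussianReal 0 1)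
    (f := fun _ t => |t| ^ (-(2 / 3) : ℝ))
    (fun _ => integrable_abs_rpow_gaussianReal (by norm_num))
  refine h.mono' ?_ ?_
  · refine Measurable.aestronglyMeasurable ?_
    unfold dotProduct
    fun_prop
  · filter_upwards [ae_gaussianVec_ne_zero 0, ae_gaussianVec_ne_zero 1,
      ae_gaussianVec_ne_zero 2] with y h0 h1 h2
    rw [Real.norm_of_nonneg (inv_nonneg.2 (dotProduct_self_nonneg y))]
    simp only [Fin.prod_univ_three, Real.rpow_neg (abs_nonneg _), ← mul_inv]
    have hp : ∀ t : ℝ, t ≠ 0 → 0 < |t| ^ (2 / 3 : ℝ) := fun t ht =>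
      Real.rpow_pos_of_pos (abs_pos.2 ht) _
    refine inv_anti₀ (mul_pos (mul_pos (hp _ h0) (hp _ h1)) (hp _ h2)) ?_
    have hr : ∀ t : ℝ, |t| ^ (2 / 3 : ℝ) = (t ^ 2) ^ (1 / 3 : ℝ) := fun t => by
      rw [← sq_abs, ← Real.rpow_natCast, ← Real.rpow_mul (abs_nonneg _)]; norm_num
    rw [hr, hr, hr]
    refine (Real.geom_mean_le_arith_mean3_weighted (by norm_num) (by norm_num) (by norm_num)
      (sq_nonneg _) (sq_nonneg _) (sq_nonneg _) (by norm_num)).trans ?_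
    simp only [dotProduct, Fin.sum_univ_three]
    nlinarith [sq_nonneg (y 0), sq_nonneg (y 1), sq_nonneg (y 2)]

lemma exists_orthonormal_orthogonal {m k p : ℕ} (h : k + m ≤ p) (x : Fin m → Fin p → ℝ) :
    ∃ e : Fin k → Param p, Orthonormal ℝ e ∧ ∀ i j, (e i).ofLp ⬝ᵥ x j = 0 := by
  set V : Submodule ℝ (Param p) := Submodule.span ℝ (Set.range fun j => WithLp.toLp 2 (x j))
  have hV : Module.finrank ℝ V ≤ m := by
    exact (finrank_range_le_card (R := ℝ) (fun j => (WithLp.toLp 2 (x j) : Param p))).trans_eq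
      (Fintype.card_fin m)
  have hd : k ≤ Module.finrank ℝ Vᗮ := by
    have := V.finrank_add_finrank_orthogonal
    rw [finrank_euclideanSpace_fin] at this
    omega
  let b := stdOrthonormalBasis ℝ Vᗮ
  refine ⟨fun i => (b (Fin.castLE hd i) : Param p), ?_, fun i j => ?_⟩
  · exact (b.orthonormal.comp_linearIsometry Vᗮ.subtypeₗᵢ).comp _ (Fin.castLE_injective hd)
  · have := Submodule.inner_right_of_mem_orthogonal
      (Submodule.subset_span ⟨j, rfl⟩ : (WithLp.toLp 2 (x j) : Param p) ∈ V)
      (b (Fin.castLE hd i)).2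
    rw [PiLp.inner_apply] at this
    simpa [dotProduct, mul_comm] using this

end Gaussian

/-! ### Measurability of the matrices built from the features -/

/-- The feature matrix whose columns are the vectors `x b`. -/
def featureMatrix {n p : ℕ} (x : Fin n → Fin p → ℝ) : Matrix (Fin p) (Fin n) ℝ :=
  Matrix.of fun a b => x b a

section Measurability

variable {n p : ℕ}

lemma continuous_gram :
    Continuous fun x : Fin n → Fin p → ℝ => (featureMatrix x)ᵀ * featureMatrix x := by
  have h : Continuous fun x : Fin n → Fin p → ℝ => featureMatrix x :=
    continuous_matrix fun a b => by simp only [featureMatrix, Matrix.of_apply]; fun_prop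
  exact h.matrix_transpose.matrix_mul h

lemma measurable_gram_inv_apply (i j : Fin n) :
    Measurable fun x : Fin n → Fin p → ℝ => ((featureMatrix x)ᵀ * featureMatrix x)⁻¹ i j := by
  simp only [Matrix.inv_def, Ring.inverse_eq_inv', Matrix.smul_apply, smul_eq_mul]
  exact continuous_gram.matrix_det.measurable.inv.mul
    ((continuous_gram.matrix_adjugate.matrix_elem i j).measurable)

lemma measurable_featureMatrix_apply (a : Fin p) (b : Fin n) :
    Measurable fun x : Fin n → Fin p → ℝ => featureMatrix x a b := by
  simp only [featureMatrix, Matrix.of_apply]; fun_prop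

lemma measurable_pinv_apply (a : Fin p) (b : Fin n) :
    Measurable fun x : Fin n → Fin p → ℝ => pinv (featureMatrix x) a b := by
  simp only [pinv, Matrix.mul_apply (M := featureMatrix _)]
  exact Finset.measurable_fun_sum _ fun c _ =>
    (measurable_featureMatrix_apply a c).mul (measurable_gram_inv_apply c b)

lemma measurable_proj_apply (a b : Fin p) :
    Measurable fun x : Fin n → Fin p → ℝ => proj (featureMatrix x) a b := by
  simp only [proj, Matrix.mul_apply (M := pinv _), Matrix.transpose_apply]
  exact Finset.measurable_fun_sum _ fun c _ =>
    (measurable_pinv_apply a c).mul (measurable_featureMatrix_apply b c)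

end Measurability

/-! ### Invertibility and integrability of the inverse Gram matrix -/

section Gram

/-- The vector `a = |y|⁻² ∑ y i e i` satisfies `Xᵀ a = e_j`, so its projection is `X⁺ e_j`, whose
squared norm is the diagonal entry. A projection does not increase the norm, and `|a|² = |y|⁻²`. -/
lemma gram_inv_apply_self_le {n p k : ℕ} (X : Matrix (Fin p) (Fin n) ℝ) (j : Fin n)
    (e : Fin k → Param p) (he : Orthonormal ℝ e)
    (horth : ∀ i l, l ≠ j → (e i).ofLp ⬝ᵥ Xᵀ l = 0) (y : Fin k → ℝ)
    (hy : ∀ i, (e i).ofLp ⬝ᵥ Xᵀ j = y i) (hy0 : y ⬝ᵥ y ≠ 0) :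
    (Xᵀ * X)⁻¹ j j ≤ (y ⬝ᵥ y)⁻¹ := by
  set a : Param p := ∑ i, ((y ⬝ᵥ y)⁻¹ * y i) • e i with ha
  have haofLp : a.ofLp = ∑ i, ((y ⬝ᵥ y)⁻¹ * y i) • (e i).ofLp := by
    simp [ha, WithLp.ofLp_sum]
  have hXa : Xᵀ *ᵥ a.ofLp = Pi.single j 1 := by
    ext l
    have h1 : (Xᵀ *ᵥ a.ofLp) l = ∑ i, ((y ⬝ᵥ y)⁻¹ * y i) * ((e i).ofLp ⬝ᵥ Xᵀ l) := by
      rw [haofLp, Matrix.mulVec_sum, Finset.sum_apply]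
      refine Finset.sum_congr rfl fun i _ => ?_
      rw [Matrix.mulVec_smul, Pi.smul_apply, smul_eq_mul, dotProduct_comm (e i).ofLp]
      rfl
    rw [h1]
    by_cases hl : l = j
    · subst hl
      simp only [hy, Pi.single_eq_same, mul_assoc, ← Finset.mul_sum]
      exact inv_mul_cancel₀ hy0
    · simp [horth _ l hl, hl]
  have hnorm : a.ofLp ⬝ᵥ a.ofLp = (y ⬝ᵥ y)⁻¹ := by
    rw [← norm_sq_eq_dotProduct, ← real_inner_self_eq_norm_sq, ha, he.inner_sum]
    simp only [conj_trivial]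
    have : ∀ i, (y ⬝ᵥ y)⁻¹ * y i * ((y ⬝ᵥ y)⁻¹ * y i) =
        (y ⬝ᵥ y)⁻¹ * (y ⬝ᵥ y)⁻¹ * (y i * y i) := fun i => by ring
    simp only [this, ← Finset.mul_sum]
    rw [mul_assoc]
    change (y ⬝ᵥ y)⁻¹ * ((y ⬝ᵥ y)⁻¹ * (y ⬝ᵥ y)) = _
    rw [inv_mul_cancel₀ hy0, mul_one]
  have hG : (Xᵀ * X)⁻¹ j j = a.ofLp ⬝ᵥ proj X *ᵥ a.ofLp := by
    rw [← proj_mulVec_dotProduct_self, proj, ← Matrix.mulVec_mulVec, hXa,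
      pinv_mulVec_dotProduct_self]
    simp
  rw [hG, ← hnorm]
  exact dotProduct_proj_mulVec_le X _

lemma gram_inv_apply_self_nonneg {n p : ℕ} (X : Matrix (Fin p) (Fin n) ℝ) (j : Fin n) :
    0 ≤ (Xᵀ * X)⁻¹ j j := by
  have h := pinv_mulVec_dotProduct_self X (Pi.single j 1)
  have h2 := dotProduct_self_nonneg (pinv X *ᵥ (Pi.single j 1))
  rw [h] at h2
  simpa using h2

lemma abs_gram_inv_apply_le {n p : ℕ} (X : Matrix (Fin p) (Fin n) ℝ) (i j : Fin n) :
    |(Xᵀ * X)⁻¹ i j| ≤ (Xᵀ * X)⁻¹ i i + (Xᵀ * X)⁻¹ j j := by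
  have h : ∀ i j, (Xᵀ * X)⁻¹ i j = ∑ a, pinv X a i * pinv X a j := fun i j => by
    rw [← transpose_pinv_mul_pinv, Matrix.mul_apply]; rfl
  rw [h, h, h, ← Finset.sum_add_distrib]
  refine (Finset.abs_sum_le_sum_abs _ _).trans (Finset.sum_le_sum fun a _ => ?_)
  rw [abs_le]
  constructor <;> nlinarith [sq_nonneg (pinv X a i + pinv X a j),
    sq_nonneg (pinv X a i - pinv X a j), sq_nonneg (pinv X a i), sq_nonneg (pinv X a j)]

lemma det_gram_ne_zero {n p : ℕ} (x : Fin n → Fin p → ℝ) (h : LinearIndependent ℝ x) :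
    ((featureMatrix x)ᵀ * featureMatrix x).det ≠ 0 := by
  intro h0
  obtain ⟨c, hc, hc0⟩ := Matrix.exists_mulVec_eq_zero_iff.2 h0
  refine hc ?_
  have h1 : featureMatrix x *ᵥ c = 0 := by
    have : (featureMatrix x *ᵥ c) ⬝ᵥ (featureMatrix x *ᵥ c) = 0 := by
      rw [Matrix.dotProduct_mulVec, ← Matrix.mulVec_transpose, Matrix.mulVec_mulVec, hc0,
        zero_dotProduct]
    exact dotProduct_self_eq_zero.1 this
  funext i
  refine Fintype.linearIndependent_iff.1 h c ?_ i
  rw [← h1]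
  ext a
  simp [Matrix.mulVec, dotProduct, featureMatrix, mul_comm]

/-- The standard Gaussian measure on `n` feature vectors. -/
noncomputable abbrev featureLaw (n p : ℕ) : Measure (Fin n → Fin p → ℝ) :=
  Measure.pi fun _ => gaussianVec p

/-- Isolates column `j` as a Gaussian vector independent of the other columns, so that Fubini allows
conditioning on those. -/
lemma measurePreserving_insertNth (n p : ℕ) (j : Fin (n + 1)) :
    MeasurePreserving
      (fun q : (Fin n → Fin p → ℝ) × (Fin p → ℝ) =>
        (Fin.insertNth (α := fun _ => Fin p → ℝ) j q.2 q.1 : Fin (n + 1) → Fin p → ℝ))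
      ((featureLaw n p).prod (gaussianVec p)) (featureLaw (n + 1) p) :=
  ((measurePreserving_piFinSuccAbove (fun _ : Fin (n + 1) => gaussianVec p) j).symm).comp
    Measure.measurePreserving_swap

/-- Given the previous columns, choose a unit vector orthogonal to them. Its product with the new
column is a Gaussian variable, hence almost surely nonzero, whereas it would vanish if the new
column were in their span. -/
lemma ae_linearIndependent (n p : ℕ) (h : n ≤ p) :
    ∀ᵐ x ∂featureLaw n p, LinearIndependent ℝ x := by
  induction n with
  | zero => exact Filter.Eventually.of_forall fun x => linearIndependent_empty_type
  | succ m ih =>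
    have hmp := measurePreserving_insertNth m p 0
    have hms : MeasurableSet {x : Fin (m + 1) → Fin p → ℝ | LinearIndependent ℝ x} :=
      isOpen_setOfPred_linearIndependent.measurableSet
    rw [← hmp.map_eq, ae_map_iff hmp.measurable.aemeasurable hms]
    refine (Measure.ae_prod_iff_ae_ae (hmp.measurable hms)).2 ?_
    filter_upwards [ih (by omega)] with x hx
    obtain ⟨e, he, horth⟩ := exists_orthonormal_orthogonal (k := 1) (by omega : 1 + m ≤ p) x
    filter_upwards [(measurePreserving_inner_gaussianVec e he).quasiMeasurePreserving.ae
      (ae_gaussianVec_ne_zero 0)] with a ha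
    rw [Fin.insertNth_zero', linearIndependent_finCons]
    refine ⟨hx, fun hmem => ha ?_⟩
    refine Submodule.span_induction (p := fun y _ => (e 0).ofLp ⬝ᵥ y = 0) ?_ ?_ ?_ ?_ hmem
    · rintro _ ⟨j, rfl⟩; exact horth 0 j
    · simp
    · intro u v _ _ hu hv; rw [dotProduct_add, hu, hv, add_zero]
    · intro c u _ hu; rw [dotProduct_smul, hu, smul_zero]

lemma ae_det_gram_ne_zero {n p : ℕ} (h : n ≤ p) :
    ∀ᵐ x ∂featureLaw n p, ((featureMatrix x)ᵀ * featureMatrix x).det ≠ 0 :=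
  (ae_linearIndependent n p h).mono fun x hx => det_gram_ne_zero x hx

lemma integrable_gram_inv_apply_self {n p : ℕ} (h : n + 2 ≤ p) (j : Fin n) :
    Integrable (fun x => ((featureMatrix x)ᵀ * featureMatrix x)⁻¹ j j) (featureLaw n p) := by
  obtain ⟨m, rfl⟩ : ∃ m, n = m + 1 := ⟨n - 1, by have := j.2; omega⟩
  have hmp := measurePreserving_insertNth m p j
  have hmeas := measurable_gram_inv_apply (n := m + 1) (p := p) j j
  have hlt : ∫⁻ y, ENNReal.ofReal ((y ⬝ᵥ y)⁻¹) ∂gaussianVec 3 < ⊤ := by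
    refine (lintegral_mono fun y => ?_).trans_lt integrable_inv_norm_sq_gaussianVec_three.2
    exact Real.ofReal_le_enorm _
  refine ⟨hmeas.aestronglyMeasurable, ?_⟩
  have henorm : ∀ x : Fin (m + 1) → Fin p → ℝ,
      ‖((featureMatrix x)ᵀ * featureMatrix x)⁻¹ j j‖ₑ =
        ENNReal.ofReal (((featureMatrix x)ᵀ * featureMatrix x)⁻¹ j j) := fun x =>
    Real.enorm_of_nonneg (gram_inv_apply_self_nonneg _ j)
  simp only [HasFiniteIntegral, henorm]
  rw [← hmp.lintegral_comp hmeas.ennreal_ofReal]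
  refine (lintegral_prod _ (hmeas.ennreal_ofReal.comp hmp.measurable).aemeasurable).trans_lt ?_
  refine (lintegral_mono (g := fun _ => ∫⁻ y, ENNReal.ofReal ((y ⬝ᵥ y)⁻¹) ∂gaussianVec 3)
    fun x => ?_).trans_lt (by simpa using hlt)
  -- There are `m = n - 1` other columns, so `n + 2 ≤ p` leaves exactly the three orthogonal
  -- directions needed.
  obtain ⟨e, he, horth⟩ := exists_orthonormal_orthogonal (k := 3) (by omega : 3 + m ≤ p) x
  have hpe := measurePreserving_inner_gaussianVec e he
  rw [← hpe.lintegral_comp (by unfold dotProduct; fun_prop)]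
  refine lintegral_mono_ae ?_
  filter_upwards [hpe.quasiMeasurePreserving.ae (ae_gaussianVec_ne_zero 0)] with a ha
  refine ENNReal.ofReal_le_ofReal (gram_inv_apply_self_le _ j e he ?_ _ ?_ ?_)
  · intro i l hl
    obtain ⟨l', rfl⟩ := Fin.exists_succAbove_eq hl
    rw [← horth i l']
    congr 1
    ext b
    simp [featureMatrix]
  · intro i
    congr 1
    ext b
    simp [featureMatrix]
  · exact fun h0 => ha (congrFun (dotProduct_self_eq_zero.1 h0) 0)

end Gram

/-! ### Expectations over the data of one task -/

section SingleTask

variable {n p : ℕ}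

lemma measurePreserving_mulVec_gaussianVec (U : Matrix (Fin p) (Fin p) ℝ) (hU : U * Uᵀ = 1) :
    MeasurePreserving (fun x => U *ᵥ x) (gaussianVec p) (gaussianVec p) := by
  refine measurePreserving_inner_gaussianVec (fun i => (WithLp.toLp 2 (U i) : Param p)) ?_
  rw [orthonormal_iff_ite]
  intro i j
  rw [PiLp.inner_apply, ← Matrix.one_apply, ← hU, Matrix.mul_apply]
  exact Finset.sum_congr rfl fun c _ => by simp [mul_comm]

lemma measurePreserving_mulVec_featureLaw (U : Matrix (Fin p) (Fin p) ℝ) (hU : U * Uᵀ = 1) :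
    MeasurePreserving (fun (x : Fin n → Fin p → ℝ) b => U *ᵥ x b) (featureLaw n p)
      (featureLaw n p) :=
  measurePreserving_pi _ _ fun _ => measurePreserving_mulVec_gaussianVec U hU

lemma featureMatrix_mulVec (U : Matrix (Fin p) (Fin p) ℝ) (x : Fin n → Fin p → ℝ) :
    featureMatrix (fun b => U *ᵥ x b) = U * featureMatrix x := by
  ext a b
  simp [featureMatrix, Matrix.mul_apply, Matrix.mulVec, dotProduct]

lemma integral_proj_apply_eq_orthogonal (U : Matrix (Fin p) (Fin p) ℝ) (hU : U * Uᵀ = 1)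
    (a b : Fin p) :
    ∫ x, proj (featureMatrix x) a b ∂featureLaw n p =
      ∫ x, (U * proj (featureMatrix x) * Uᵀ) a b ∂featureLaw n p := by
  have hmp := measurePreserving_mulVec_featureLaw (n := n) U hU
  conv_lhs => rw [← hmp.map_eq]
  rw [integral_map hmp.measurable.aemeasurable
    (measurable_proj_apply a b).aestronglyMeasurable]
  simp only [featureMatrix_mulVec]
  congr 1
  ext x
  rw [proj_mul_orthogonal _ _ (mul_eq_one_comm.1 hU)]

/-- Reflecting coordinate `a` preserves the law of the features and flips the sign of this entry. -/
lemma integral_proj_apply_of_ne {a b : Fin p} (hab : a ≠ b) :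
    ∫ x, proj (featureMatrix x) a b ∂featureLaw n p = 0 := by
  set s : Fin p → ℝ := fun i => if i = a then -1 else 1 with hs
  have hU : Matrix.diagonal s * (Matrix.diagonal s)ᵀ = 1 := by
    rw [Matrix.diagonal_transpose, Matrix.diagonal_mul_diagonal, ← Matrix.diagonal_one]
    congr 1
    ext i
    simp only [hs]
    split_ifs <;> norm_num
  have h := integral_proj_apply_eq_orthogonal (n := n) _ hU a b
  simp only [Matrix.diagonal_transpose, Matrix.mul_diagonal, Matrix.diagonal_mul] at h
  have ha : s a = -1 := by simp [hs]
  have hb : s b = 1 := by simp [hs, hab.symm]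
  simp only [ha, hb, mul_one, neg_mul, one_mul, integral_neg] at h
  linarith

lemma integral_proj_apply_self_eq (a b : Fin p) :
    ∫ x, proj (featureMatrix x) a a ∂featureLaw n p =
      ∫ x, proj (featureMatrix x) b b ∂featureLaw n p := by
  set U : Matrix (Fin p) (Fin p) ℝ := (Equiv.swap a b).toPEquiv.toMatrix with hUdef
  have hUt : Uᵀ = U := by
    rw [hUdef, ← PEquiv.toMatrix_symm, ← Equiv.toPEquiv_symm, Equiv.symm_swap]
  have hU : U * Uᵀ = 1 := by
    rw [hUt, hUdef, PEquiv.toMatrix_toPEquiv_mul]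
    ext i j
    simp [PEquiv.toMatrix_apply, Matrix.one_apply]
  rw [integral_proj_apply_eq_orthogonal (n := n) U hU a a, hUt, hUdef]
  congr 1
  ext x
  rw [PEquiv.toMatrix_toPEquiv_mul, PEquiv.mul_toMatrix_toPEquiv]
  simp

lemma integrable_proj_apply (a b : Fin p) :
    Integrable (fun x => proj (featureMatrix x) a b) (featureLaw n p) :=
  Integrable.of_bound (measurable_proj_apply a b).aestronglyMeasurable 1
    (Filter.Eventually.of_forall fun _ => abs_proj_apply_le _ a b)

/-- Swapping coordinates makes all diagonal means equal, and they share the almost sure trace `n`.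
-/
lemma integral_proj_apply (h : n ≤ p) (a b : Fin p) :
    ∫ x, proj (featureMatrix x) a b ∂featureLaw n p = if a = b then (n : ℝ) / p else 0 := by
  split_ifs with hab
  · subst hab
    have hp : (p : ℝ) ≠ 0 := by
      have := a.2
      exact Nat.cast_ne_zero.2 (by omega)
    have h1 : ∫ x, (proj (featureMatrix x)).trace ∂featureLaw n p = n := by
      rw [integral_congr_ae (g := fun _ => (n : ℝ))
        ((ae_det_gram_ne_zero h).mono fun _ hx => trace_proj _ hx)]
      simp
    simp only [Matrix.trace, Matrix.diag_apply] at h1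
    rw [integral_finsetSum _ fun i _ => integrable_proj_apply i i,
      Finset.sum_congr rfl fun i _ => integral_proj_apply_self_eq i a] at h1
    simp only [Finset.sum_const, Finset.card_univ, Fintype.card_fin, nsmul_eq_mul] at h1
    rw [eq_div_iff hp, mul_comm]
    exact h1
  · exact integral_proj_apply_of_ne hab

lemma dotProduct_mulVec_eq_sum {ι κ : Type*} [Fintype ι] [Fintype κ] (M : Matrix ι κ ℝ)
    (v : ι → ℝ) (w : κ → ℝ) : v ⬝ᵥ M *ᵥ w = ∑ a, ∑ b, v a * w b * M a b := by
  simp only [Matrix.mulVec, dotProduct, Finset.mul_sum]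
  exact Finset.sum_congr rfl fun a _ => Finset.sum_congr rfl fun b _ => by ring

lemma integrable_dotProduct_proj (v : Fin p → ℝ) :
    Integrable (fun x => v ⬝ᵥ proj (featureMatrix x) *ᵥ v) (featureLaw n p) := by
  simp only [dotProduct_mulVec_eq_sum]
  exact integrable_finsetSum _ fun a _ => integrable_finsetSum _ fun b _ =>
    (integrable_proj_apply a b).const_mul _

lemma integral_dotProduct_proj (h : n ≤ p) (v : Fin p → ℝ) :
    ∫ x, v ⬝ᵥ proj (featureMatrix x) *ᵥ v ∂featureLaw n p = n / p * (v ⬝ᵥ v) := by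
  simp only [dotProduct_mulVec_eq_sum]
  rw [integral_finsetSum _ fun a _ => integrable_finsetSum _ fun b _ =>
    (integrable_proj_apply a b).const_mul _]
  simp only [dotProduct, Finset.mul_sum]
  refine Finset.sum_congr rfl fun a _ => ?_
  rw [integral_finsetSum _ fun b _ => (integrable_proj_apply a b).const_mul _]
  simp only [integral_const_mul, integral_proj_apply h]
  simp
  ring

/-- The law of the features and the noise of one task. -/
noncomputable abbrev taskLaw (n p : ℕ) (σ : ℝ≥0) : Measure ((Fin n → Fin p → ℝ) × (Fin n → ℝ)) :=
  (featureLaw n p).prod (Measure.pi fun _ => gaussianReal 0 (σ ^ 2))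

variable (σ : ℝ≥0)

lemma integrable_noise_mul (i j : Fin n) :
    Integrable (fun z : Fin n → ℝ => z i * z j)
      (Measure.pi fun _ : Fin n => gaussianReal 0 (σ ^ 2)) := by
  have h : ∀ i : Fin n, MemLp (fun z : Fin n → ℝ => z i) 2
      (Measure.pi fun _ : Fin n => gaussianReal 0 (σ ^ 2)) := fun i =>
    (memLp_id_gaussianReal (μ := 0) (v := σ ^ 2) 2).comp_measurePreserving
      (measurePreserving_eval (fun _ : Fin n => gaussianReal 0 (σ ^ 2)) i)
  exact (h i).integrable_mul (h j)

lemma integrable_gram_inv_apply (h : n + 2 ≤ p) (i j : Fin n) :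
    Integrable (fun x => ((featureMatrix x)ᵀ * featureMatrix x)⁻¹ i j) (featureLaw n p) :=
  ((integrable_gram_inv_apply_self h i).add (integrable_gram_inv_apply_self h j)).mono'
    (measurable_gram_inv_apply i j).aestronglyMeasurable
    (Filter.Eventually.of_forall fun _ => abs_gram_inv_apply_le _ i j)

lemma integrable_pinv_mulVec_sq (h : n + 2 ≤ p) :
    Integrable (fun d => (pinv (featureMatrix d.1) *ᵥ d.2) ⬝ᵥ (pinv (featureMatrix d.1) *ᵥ d.2))
      (taskLaw n p σ) := by
  simp only [pinv_mulVec_dotProduct_self]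
  simp only [dotProduct_mulVec_eq_sum]
  refine integrable_finsetSum _ fun i _ => integrable_finsetSum _ fun j _ => ?_
  exact ((integrable_gram_inv_apply h i j).mul_prod (integrable_noise_mul σ i j)).congr
    (Filter.Eventually.of_forall fun d => mul_comm _ _)

lemma measurable_dotProduct_pinv (v : Fin p → ℝ) :
    Measurable fun d : (Fin n → Fin p → ℝ) × (Fin n → ℝ) =>
      v ⬝ᵥ pinv (featureMatrix d.1) *ᵥ d.2 := by
  simp only [dotProduct_mulVec_eq_sum]
  refine Finset.measurable_fun_sum _ fun a _ => Finset.measurable_fun_sum _ fun b _ => ?_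
  have h1 : Measurable fun d : (Fin n → Fin p → ℝ) × (Fin n → ℝ) =>
      pinv (featureMatrix d.1) a b := (measurable_pinv_apply a b).comp measurable_fst
  have h2 : Measurable fun d : (Fin n → Fin p → ℝ) × (Fin n → ℝ) => v a * d.2 b := by fun_prop
  exact h2.mul h1

lemma integrable_dotProduct_pinv (h : n + 2 ≤ p) (v : Fin p → ℝ) :
    Integrable (fun d => v ⬝ᵥ pinv (featureMatrix d.1) *ᵥ d.2) (taskLaw n p σ) := by
  refine ((integrable_const (v ⬝ᵥ v)).add (integrable_pinv_mulVec_sq σ h)).mono'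
    (measurable_dotProduct_pinv v).aestronglyMeasurable
    (Filter.Eventually.of_forall fun d => ?_)
  -- Nonnegativity of `|v ± w|²` gives `2 |v ⬝ᵥ w| ≤ |v|² + |w|²`, a dominating integrable function.
  set w := pinv (featureMatrix d.1) *ᵥ d.2 with hw
  have h1 := dotProduct_self_nonneg (v + w)
  have h2 := dotProduct_self_nonneg (v - w)
  have h3 := dotProduct_self_nonneg v
  have h4 := dotProduct_self_nonneg w
  simp only [add_dotProduct, dotProduct_add, sub_dotProduct, dotProduct_sub,
    dotProduct_comm w v] at h1 h2
  simp only [Pi.add_apply, Real.norm_eq_abs, abs_le, ← hw]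
  constructor <;> linarith

/-- The map `X ↦ -X` preserves the law and negates `pinv`, so the integral equals its own negative.
-/
lemma integral_dotProduct_pinv (v : Fin p → ℝ) :
    ∫ d, v ⬝ᵥ pinv (featureMatrix d.1) *ᵥ d.2 ∂taskLaw n p σ = 0 := by
  have hmp : MeasurePreserving (fun d : (Fin n → Fin p → ℝ) × (Fin n → ℝ) =>
      ((fun b => (-1 : Matrix (Fin p) (Fin p) ℝ) *ᵥ d.1 b), d.2)) (taskLaw n p σ)
      (taskLaw n p σ) :=
    (measurePreserving_mulVec_featureLaw (-1) (by simp)).prod (MeasurePreserving.id _)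
  have h : ∫ d, v ⬝ᵥ pinv (featureMatrix d.1) *ᵥ d.2 ∂taskLaw n p σ =
      ∫ d, -(v ⬝ᵥ pinv (featureMatrix d.1) *ᵥ d.2) ∂taskLaw n p σ := by
    conv_lhs => rw [← hmp.map_eq]
    rw [integral_map hmp.measurable.aemeasurable
      (measurable_dotProduct_pinv v).aestronglyMeasurable]
    simp only [featureMatrix_mulVec]
    simp only [Matrix.neg_mul, Matrix.one_mul, pinv_neg, Matrix.neg_mulVec, dotProduct_neg]
  rw [integral_neg] at h
  linarith

/-- The expected squared contribution of the label noise to one training step. -/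
noncomputable def noiseError (n p : ℕ) (σ : ℝ≥0) : ℝ :=
  ∫ d, (pinv (featureMatrix d.1) *ᵥ d.2) ⬝ᵥ (pinv (featureMatrix d.1) *ᵥ d.2) ∂taskLaw n p σ

/-- One training step on the data `d` of a task with optimal model `wstar`. -/
noncomputable def taskStep (wstar : Fin p → ℝ) (d : (Fin n → Fin p → ℝ) × (Fin n → ℝ))
    (w : Fin p → ℝ) : Fin p → ℝ :=
  step (featureMatrix d.1) ((featureMatrix d.1)ᵀ *ᵥ wstar + d.2) w

lemma integrable_taskStep_sq_and_integral (h : n + 2 ≤ p) (wstar w v : Fin p → ℝ) :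
    Integrable (fun d => (taskStep wstar d w - v) ⬝ᵥ (taskStep wstar d w - v)) (taskLaw n p σ) ∧
    ∫ d, (taskStep wstar d w - v) ⬝ᵥ (taskStep wstar d w - v) ∂taskLaw n p σ =
      (1 - n / p) * ((w - v) ⬝ᵥ (w - v)) + n / p * ((wstar - v) ⬝ᵥ (wstar - v))
        + noiseError n p σ := by
  have hP : ∀ a : Fin p → ℝ, Integrable (fun d : (Fin n → Fin p → ℝ) × (Fin n → ℝ) =>
      a ⬝ᵥ proj (featureMatrix d.1) *ᵥ a) (taskLaw n p σ) := fun a =>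
    (integrable_dotProduct_proj a).comp_fst _
  have hPi : ∀ a : Fin p → ℝ, ∫ d, a ⬝ᵥ proj (featureMatrix d.1) *ᵥ a ∂taskLaw n p σ =
      n / p * (a ⬝ᵥ a) := fun a => by
    rw [← integral_dotProduct_proj (by omega : n ≤ p)]
    have := integral_fun_fst (μ := featureLaw n p)
      (ν := Measure.pi fun _ : Fin n => gaussianReal 0 (σ ^ 2))
      (fun x => a ⬝ᵥ proj (featureMatrix x) *ᵥ a)
    simpa using this
  have h1 := (integrable_const (μ := taskLaw n p σ) ((w - v) ⬝ᵥ (w - v))).sub (hP (w - v))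
  have h2 := h1.add (hP (wstar - v))
  have h3 := h2.add (integrable_pinv_mulVec_sq σ h)
  have h4 := (integrable_dotProduct_pinv σ h (wstar - v)).const_mul 2
  simp only [taskStep, step_sub_dotProduct_self]
  refine ⟨h3.add h4, (integral_add h3 h4).trans ?_⟩
  rw [integral_add' h2 (integrable_pinv_mulVec_sq σ h),
    integral_add' h1 (hP _), integral_sub' (integrable_const _) (hP _), hPi, hPi,
    integral_const_mul, integral_dotProduct_pinv, noiseError]
  simp
  ring

end SingleTask

/-! ### Independence of the iterates and the error recursion -/

section Iterates

variable {T n p : ℕ}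

/-- The features and the noise of one task. -/
abbrev TaskData (n p : ℕ) := (Fin n → Fin p → ℝ) × (Fin n → ℝ)

/-- The joint law of the data of `T` tasks. -/
noncomputable abbrev dataLaw (T n p : ℕ) (σ : ℝ≥0) : Measure (Fin T → TaskData n p) :=
  Measure.pi fun _ => taskLaw n p σ

lemma measurable_taskStep (wstar : Fin p → ℝ) :
    Measurable fun q : (Fin p → ℝ) × TaskData n p => taskStep wstar q.2 q.1 := by
  refine measurable_pi_lambda _ fun a => ?_
  simp only [taskStep, step, Pi.add_apply, Pi.sub_apply, Matrix.mulVec, dotProduct,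
    Matrix.transpose_apply, featureMatrix, Matrix.of_apply]
  refine Measurable.add (by fun_prop) (Finset.measurable_fun_sum _ fun b _ => ?_)
  refine Measurable.mul ?_ (by fun_prop)
  exact (measurable_pinv_apply a b).comp (measurable_fst.comp measurable_snd)

/-- The parameters after the first `t` tasks, computed with the closed form of the steps. -/
noncomputable def modelAfter (wstar : Fin T → Fin p → ℝ) :
    ℕ → (Fin T → TaskData n p) → Fin p → ℝ
  | 0, _ => 0
  | t + 1, d =>
    if h : t < T then taskStep (wstar ⟨t, h⟩) (d ⟨t, h⟩) (modelAfter wstar t d)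
    else modelAfter wstar t d

/-- The σ-algebra generated by the data of the first `t` tasks. -/
abbrev pastData (T n p t : ℕ) : MeasurableSpace (Fin T → TaskData n p) :=
  ⨆ k ∈ {k : Fin T | (k : ℕ) < t}, MeasurableSpace.comap (fun d => d k) inferInstance

lemma pastData_mono {s t : ℕ} (h : s ≤ t) : pastData T n p s ≤ pastData T n p t :=
  biSup_mono fun _ hk => lt_of_lt_of_le hk h

lemma measurable_modelAfter_pastData (wstar : Fin T → Fin p → ℝ) (t : ℕ) :
    Measurable[pastData T n p t] (modelAfter (n := n) wstar t) := by
  induction t with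
  | zero => exact @measurable_const _ _ _ (pastData T n p 0) 0
  | succ t ih =>
    have ih' : Measurable[pastData T n p (t + 1)] (modelAfter (n := n) wstar t) :=
      ih.mono (pastData_mono (Nat.le_succ t)) le_rfl
    by_cases h : t < T
    · have heval : Measurable[pastData T n p (t + 1)]
          (fun d : Fin T → TaskData n p => d ⟨t, h⟩) := by
        rw [measurable_iff_comap_le]
        exact le_biSup (fun k : Fin T => MeasurableSpace.comap
          (fun d : Fin T → TaskData n p => d k) inferInstance)
          (show (⟨t, h⟩ : Fin T) ∈ {k : Fin T | (k : ℕ) < t + 1} from Nat.lt_succ_self t)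
      have := (measurable_taskStep (n := n) (wstar ⟨t, h⟩)).comp (ih'.prodMk heval)
      convert this using 1
      ext d : 1
      simp [modelAfter, h]
    · convert ih' using 1
      ext d : 1
      simp [modelAfter, h]

lemma pastData_le (t : ℕ) : pastData T n p t ≤ MeasurableSpace.pi :=
  iSup₂_le fun k _ => (measurable_pi_apply k).comap_le

lemma measurable_modelAfter (wstar : Fin T → Fin p → ℝ) (t : ℕ) :
    Measurable (modelAfter (n := n) wstar t) :=
  (measurable_modelAfter_pastData wstar t).mono (pastData_le t) le_rfl

variable (σ : ℝ≥0)

/-- With positions numbered from `0`, the iterate `t` uses only data at indices below `t`, a set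
disjoint from `{t}`. -/
lemma indepFun_modelAfter_eval (wstar : Fin T → Fin p → ℝ) (t : Fin T) :
    IndepFun (modelAfter (n := n) wstar t) (fun d => d t) (dataLaw T n p σ) := by
  have hind : iIndepFun (fun (k : Fin T) (d : Fin T → TaskData n p) => d k) (dataLaw T n p σ) :=
    iIndepFun_pi (X := fun _ x => x) fun _ => aemeasurable_id
  have h := indep_iSup_of_disjoint (fun k => (measurable_pi_apply k).comap_le) hind.iIndep
    (S := {k : Fin T | (k : ℕ) < t}) (T := {t}) (by simp)
  rw [IndepFun_iff_Indep]
  refine indep_of_indep_of_le_left (indep_of_indep_of_le_right h ?_)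
    (measurable_modelAfter_pastData wstar t).comap_le
  exact le_biSup (fun k : Fin T => MeasurableSpace.comap
    (fun d : Fin T → TaskData n p => d k) inferInstance) (Set.mem_singleton t)

lemma map_modelAfter_prodMk_eval (wstar : Fin T → Fin p → ℝ) (t : Fin T) :
    (dataLaw T n p σ).map (fun d => (modelAfter wstar t d, d t)) =
      ((dataLaw T n p σ).map (modelAfter wstar t)).prod (taskLaw n p σ) := by
  rw [(indepFun_iff_map_prod_eq_prod_map_map (measurable_modelAfter wstar t).aemeasurable
    (measurable_pi_apply t).aemeasurable).1 (indepFun_modelAfter_eval σ wstar t)]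
  congr 1
  exact (measurePreserving_eval (fun _ : Fin T => taskLaw n p σ) t).map_eq

lemma measurable_sub_dotProduct_self (v : Fin p → ℝ) :
    Measurable fun w : Fin p → ℝ => (w - v) ⬝ᵥ (w - v) := by
  simp only [dotProduct, Pi.sub_apply]
  fun_prop

lemma modelAfter_succ (wstar : Fin T → Fin p → ℝ) (t : Fin T) (d : Fin T → TaskData n p) :
    modelAfter wstar (t + 1) d = taskStep (wstar t) (d t) (modelAfter wstar t d) := by
  simp [modelAfter]

/-- By independence the pair of iterate and fresh data has a product law, so Fubini reduces the
claim to the one-step expectation for fixed `w`. -/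
lemma modelAfter_sq_succ (h : n + 2 ≤ p) (wstar : Fin T → Fin p → ℝ) (t : Fin T)
    (v : Fin p → ℝ)
    (hint : Integrable (fun d => (modelAfter wstar t d - v) ⬝ᵥ (modelAfter wstar t d - v))
      (dataLaw T n p σ)) :
    Integrable (fun d => (modelAfter wstar (t + 1) d - v) ⬝ᵥ (modelAfter wstar (t + 1) d - v))
      (dataLaw T n p σ) ∧
    ∫ d, (modelAfter wstar (t + 1) d - v) ⬝ᵥ (modelAfter wstar (t + 1) d - v) ∂dataLaw T n p σ =
      (1 - n / p) *
        ∫ d, (modelAfter wstar t d - v) ⬝ᵥ (modelAfter wstar t d - v) ∂dataLaw T n p σ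
      + n / p * ((wstar t - v) ⬝ᵥ (wstar t - v)) + noiseError n p σ := by
  set g : (Fin p → ℝ) × TaskData n p → ℝ := fun q =>
    (taskStep (wstar t) q.2 q.1 - v) ⬝ᵥ (taskStep (wstar t) q.2 q.1 - v) with hg
  have hgm : Measurable g :=
    (measurable_sub_dotProduct_self v).comp (measurable_taskStep (wstar t))
  set lam := (dataLaw T n p σ).map (modelAfter wstar t) with hlam
  have hmm := measurable_modelAfter (n := n) wstar t
  have : IsProbabilityMeasure lam := Measure.isProbabilityMeasure_map hmm.aemeasurable
  have hpair : Measurable fun d : Fin T → TaskData n p => (modelAfter wstar t d, d t) :=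
    hmm.prodMk (measurable_pi_apply t)
  have hstep := fun w => integrable_taskStep_sq_and_integral (n := n) σ h (wstar t) w v
  have hsq : Integrable (fun w => (w - v) ⬝ᵥ (w - v)) lam :=
    (integrable_map_measure (measurable_sub_dotProduct_self v).aestronglyMeasurable
      hmm.aemeasurable).2 hint
  have h1 := (hsq.const_mul (1 - n / p : ℝ)).add
    (integrable_const (μ := lam) (n / p * ((wstar t - v) ⬝ᵥ (wstar t - v)) : ℝ))
  have h2 := h1.add (integrable_const (μ := lam) (noiseError n p σ))
  have hgint : Integrable g (lam.prod (taskLaw n p σ)) := by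
    refine (integrable_prod_iff hgm.aestronglyMeasurable).2
      ⟨Filter.Eventually.of_forall fun w => (hstep w).1, ?_⟩
    -- The integrand is nonnegative, so its inner norm integral is the one-step formula, an affine
    -- function of `|w - v|²`.
    refine h2.congr (Filter.Eventually.of_forall fun w => ?_)
    have : ∀ d, ‖g (w, d)‖ = g (w, d) := fun d =>
      Real.norm_of_nonneg (dotProduct_self_nonneg _)
    simp only [this]
    exact (hstep w).2.symm
  simp only [modelAfter_succ]
  have hmap := map_modelAfter_prodMk_eval (n := n) σ wstar t
  constructor
  · rw [hlam, ← hmap, integrable_map_measure hgm.aestronglyMeasurable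
      hpair.aemeasurable] at hgint
    exact hgint
  · have e1 : ∫ q, g q ∂(lam.prod (taskLaw n p σ)) =
        ∫ d, g (modelAfter wstar t d, d t) ∂dataLaw T n p σ := by
      rw [hlam, ← hmap, integral_map hpair.aemeasurable hgm.aestronglyMeasurable]
    have e2 : ∫ w, (w - v) ⬝ᵥ (w - v) ∂lam =
        ∫ d, (modelAfter wstar t d - v) ⬝ᵥ (modelAfter wstar t d - v) ∂dataLaw T n p σ := by
      rw [hlam, integral_map hmm.aemeasurable
        (measurable_sub_dotProduct_self v).aestronglyMeasurable]
    change ∫ d, g (modelAfter wstar t d, d t) ∂dataLaw T n p σ = _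
    rw [← e1, integral_prod _ hgint]
    have e3 : ∀ w, ∫ d, g (w, d) ∂taskLaw n p σ = _ := fun w => (hstep w).2
    simp only [e3]
    refine (integral_add h1 (integrable_const _)).trans ?_
    rw [integral_add' (hsq.const_mul _) (integrable_const _), integral_const_mul, e2]
    simp

/-- The expected model error after `t` tasks when task `k` has the distance `√(a k)` to the
reference model, the start has the distance `√s` and the noise contributes `N` per step. -/
noncomputable def expectedError (T : ℕ) (r s N : ℝ) (a : Fin T → ℝ) (t : ℕ) : ℝ :=
  r ^ t * s + ∑ k : Fin T, (if (k : ℕ) < t then (1 - r) * r ^ (t - 1 - k) * a k else 0)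
    + N * ∑ k ∈ Finset.range t, r ^ k

lemma expectedError_succ (r s N : ℝ) (a : Fin T → ℝ) (t : Fin T) :
    expectedError T r s N a (t + 1) =
      r * expectedError T r s N a t + (1 - r) * a t + N := by
  have h : ∑ k : Fin T, (if (k : ℕ) < t + 1 then (1 - r) * r ^ ((t : ℕ) + 1 - 1 - k) * a k else 0)
      = r * ∑ k : Fin T, (if (k : ℕ) < t then (1 - r) * r ^ ((t : ℕ) - 1 - k) * a k else 0)
        + (1 - r) * a t := by
    have : (1 - r) * a t = ∑ k : Fin T, if k = t then (1 - r) * a k else 0 := by simp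
    rw [this, Finset.mul_sum, ← Finset.sum_add_distrib]
    refine Finset.sum_congr rfl fun k _ => ?_
    -- Old tasks gain one factor `r`, task `t` enters with exponent `0`, and later tasks are cut
    -- off; the truncated exponents matter only in the first two cases.
    rcases lt_trichotomy (k : ℕ) t with hk | hk | hk
    · have h1 : (t : ℕ) + 1 - 1 - k = (t - 1 - k) + 1 := by omega
      have h2 : k ≠ t := fun h => by simp [h] at hk
      rw [if_pos hk, if_pos (by omega), if_neg h2, h1, pow_succ]
      ring
    · have h2 : k = t := Fin.ext hk
      subst h2
      simp
    · have h2 : k ≠ t := fun h => by simp [h] at hk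
      rw [if_neg (by omega), if_neg (by omega), if_neg h2]
      simp
  rw [expectedError, expectedError, h, Finset.sum_range_succ']
  simp only [pow_succ, ← Finset.sum_mul]
  ring

lemma modelAfter_sq (h : n + 2 ≤ p) (wstar : Fin T → Fin p → ℝ) (v : Fin p → ℝ)
    (t : ℕ) (ht : t ≤ T) :
    Integrable (fun d => (modelAfter wstar t d - v) ⬝ᵥ (modelAfter wstar t d - v))
      (dataLaw T n p σ) ∧
    ∫ d, (modelAfter wstar t d - v) ⬝ᵥ (modelAfter wstar t d - v) ∂dataLaw T n p σ =
      expectedError T (1 - n / p) (v ⬝ᵥ v) (noiseError n p σ)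
        (fun k => (wstar k - v) ⬝ᵥ (wstar k - v)) t := by
  induction t with
  | zero => simp [modelAfter, expectedError]
  | succ t ih =>
    obtain ⟨h1, h2⟩ := ih (by omega)
    obtain ⟨h3, h4⟩ := modelAfter_sq_succ (n := n) σ h wstar ⟨t, ht⟩ v h1
    refine ⟨h3, h4.trans ?_⟩
    rw [h2]
    have := expectedError_succ (1 - n / p : ℝ) (v ⬝ᵥ v) (noiseError n p σ)
      (fun k => (wstar k - v) ⬝ᵥ (wstar k - v)) ⟨t, ht⟩
    simp only at this
    rw [this]
    ring

end Iterates

/-! ### From entrywise Gaussian data to the expected forgetting -/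

section Law

variable {T n p : ℕ}

/-- All scalar entries of the data of `T` tasks. -/
def dataEntries (d : Fin T → TaskData n p) : (Fin T × Fin p × Fin n) ⊕ (Fin T × Fin n) → ℝ :=
  Sum.elim (fun q => (d q.1).1 q.2.2 q.2.1) (fun q => (d q.1).2 q.2)

/-- The data of `T` tasks with the given scalar entries. -/
def dataOfEntries (g : (Fin T × Fin p × Fin n) ⊕ (Fin T × Fin n) → ℝ) : Fin T → TaskData n p :=
  fun k => (fun b a => g (Sum.inl (k, a, b)), fun b => g (Sum.inr (k, b)))

lemma measurable_dataEntries : Measurable (dataEntries (T := T) (n := n) (p := p)) := by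
  refine measurable_pi_lambda _ ?_
  rintro (q | q) <;> simp only [dataEntries, Sum.elim_inl, Sum.elim_inr] <;> fun_prop

lemma measurable_dataOfEntries : Measurable (dataOfEntries (T := T) (n := n) (p := p)) := by
  unfold dataOfEntries
  fun_prop

lemma map_dataEntries (σ : ℝ≥0) :
    (dataLaw T n p σ).map dataEntries =
      Measure.pi (Sum.elim (fun _ => gaussianReal 0 1) (fun _ => gaussianReal 0 (σ ^ 2))) := by
  have : ∀ i : (Fin T × Fin p × Fin n) ⊕ (Fin T × Fin n),
      SigmaFinite (Sum.elim (fun _ => gaussianReal 0 1) (fun _ => gaussianReal 0 (σ ^ 2)) i :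
        Measure ℝ) := by
    rintro (i | i) <;> simp only [Sum.elim_inl, Sum.elim_inr] <;> infer_instance
  symm
  refine Measure.pi_eq fun s hs => ?_
  rw [Measure.map_apply measurable_dataEntries (MeasurableSet.univ_pi hs)]
  have hpre : dataEntries (T := T) (n := n) (p := p) ⁻¹' Set.univ.pi s =
      Set.univ.pi fun k => (Set.univ.pi fun b => Set.univ.pi fun a => s (Sum.inl (k, a, b))) ×ˢ
        (Set.univ.pi fun b => s (Sum.inr (k, b))) := by
    ext d
    simp only [Set.mem_preimage, Set.mem_pi, Set.mem_univ, true_imp_iff, Set.mem_prod, Sum.forall,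
      dataEntries, Sum.elim_inl, Sum.elim_inr, Prod.forall]
    exact ⟨fun h k => ⟨fun b a => h.1 k a b, fun b => h.2 k b⟩,
      fun h => ⟨fun k a b => (h k).1 b a, fun k b => (h k).2 b⟩⟩
  rw [hpre, Measure.pi_pi]
  simp only [Measure.prod_prod, Measure.pi_pi, Finset.prod_mul_distrib, Fintype.prod_sum_type,
    Fintype.prod_prod_type, Sum.elim_inl, Sum.elim_inr]
  congr 1
  exact Finset.prod_congr rfl fun k _ => Finset.prod_comm

lemma map_dataOfEntries (σ : ℝ≥0) :
    (Measure.pi (Sum.elim (fun _ => gaussianReal 0 1) (fun _ => gaussianReal 0 (σ ^ 2)))).map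
      dataOfEntries = dataLaw T n p σ := by
  rw [← map_dataEntries, Measure.map_map measurable_dataOfEntries measurable_dataEntries]
  exact Measure.map_id

/-- The data of the tasks as a function on the sample space. -/
def taskData {Ω : Type*} (X : Fin T → Ω → Matrix (Fin p) (Fin n) ℝ) (z : Fin T → Ω → Fin n → ℝ)
    (ω : Ω) : Fin T → TaskData n p :=
  fun k => (fun b a => X k ω a b, z k ω)

lemma IsGaussianData.hasLaw {Ω : Type*} [MeasurableSpace Ω] {μ : Measure Ω}
    [IsProbabilityMeasure μ] {σ : ℝ≥0}
    {X : Fin T → Ω → Matrix (Fin p) (Fin n) ℝ} {z : Fin T → Ω → Fin n → ℝ}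
    (h : IsGaussianData μ σ X z) : HasLaw (taskData X z) (dataLaw T n p σ) μ := by
  have hae : ∀ i, AEMeasurable
      (Sum.elim (fun (q : Fin T × Fin p × Fin n) (ω : Ω) => X q.1 ω q.2.1 q.2.2)
        (fun (q : Fin T × Fin n) (ω : Ω) => z q.1 ω q.2) i) μ := by
    rintro (q | q)
    · exact (h.feature_law q.1 q.2.1 q.2.2).aemeasurable
    · exact (h.noise_law q.1 q.2).aemeasurable
  have hmap := h.indep.map_fun_eq_pi_map hae
  have hlaw : (fun i => μ.map
      (Sum.elim (fun (q : Fin T × Fin p × Fin n) (ω : Ω) => X q.1 ω q.2.1 q.2.2)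
        (fun (q : Fin T × Fin n) (ω : Ω) => z q.1 ω q.2) i)) =
      Sum.elim (fun _ => gaussianReal 0 1) (fun _ => gaussianReal 0 (σ ^ 2)) := by
    funext i
    rcases i with q | q
    · exact (h.feature_law q.1 q.2.1 q.2.2).map_eq
    · exact (h.noise_law q.1 q.2).map_eq
  rw [hlaw] at hmap
  have haepi := aemeasurable_pi_lambda _ hae
  refine ⟨measurable_dataOfEntries.comp_aemeasurable haepi, ?_⟩
  rw [← map_dataOfEntries, ← hmap,
    AEMeasurable.map_map_of_aemeasurable measurable_dataOfEntries.aemeasurable haepi]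
  rfl

/-- The task data are i.i.d., so reordering changes only which optimal model sits at each position.
-/
lemma measurePreserving_comp_perm (σ : ℝ≥0) (π : Equiv.Perm (Fin T)) :
    MeasurePreserving (fun (d : Fin T → TaskData n p) k => d (π k)) (dataLaw T n p σ)
      (dataLaw T n p σ) := by
  have := measurePreserving_piCongrLeft (fun _ : Fin T => taskLaw n p σ) π.symm
  convert this using 1
  ext d k : 2
  rw [MeasurableEquiv.coe_piCongrLeft, ← π.symm_apply_apply k, Equiv.piCongrLeft_apply_apply]
  simp

/-- The forgetting as a function of the data. -/
noncomputable def forgettingOfData (wstar : Fin T → Param p) (d : Fin T → TaskData n p) : ℝ :=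
  forgetting wstar (fun k => featureMatrix (d k).1) (fun k => (d k).2)

lemma forgettingInOrder_eq {Ω : Type*} (X : Fin T → Ω → Matrix (Fin p) (Fin n) ℝ)
    (z : Fin T → Ω → Fin n → ℝ) (π : Equiv.Perm (Fin T)) (wstar : Fin T → Param p) (ω : Ω) :
    forgettingInOrder π wstar (fun k => X k ω) (fun k => z k ω) =
      forgettingOfData (fun t => wstar (π t)) (fun k => taskData X z ω (π k)) := rfl

lemma ae_trained_eq (σ : ℝ≥0) (h : n ≤ p) (wstar : Fin T → Param p) :
    ∀ᵐ d ∂dataLaw T n p σ, ∀ t,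
      trained (fun k => featureMatrix (d k).1)
        (fun k => labels (featureMatrix (d k).1) (wstar k) (d k).2) t =
      WithLp.toLp 2 (modelAfter (fun k => (wstar k).ofLp) t d) := by
  have hall : ∀ᵐ d ∂dataLaw T n p σ, ∀ k : Fin T,
      ((featureMatrix (d k).1)ᵀ * featureMatrix (d k).1).det ≠ 0 := by
    rw [ae_all_iff]
    intro k
    have h1 : ∀ᵐ e ∂taskLaw n p σ, ((featureMatrix e.1)ᵀ * featureMatrix e.1).det ≠ 0 :=
      Measure.quasiMeasurePreserving_fst.ae (ae_det_gram_ne_zero h)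
    exact (Measure.quasiMeasurePreserving_eval (μ := fun _ : Fin T => taskLaw n p σ) k).ae h1
  filter_upwards [hall] with d hd t
  induction t with
  | zero => simp [trained, modelAfter]
  | succ t ih =>
    rw [trained, modelAfter]
    split_ifs with ht
    · rw [ih, train_eq_step _ (hd _)]
      rfl
    · exact ih

lemma modelError_toLp (wstar : Param p) (w : Fin p → ℝ) :
    modelError wstar (WithLp.toLp 2 w) = (w - wstar.ofLp) ⬝ᵥ (w - wstar.ofLp) := by
  rw [modelError, norm_sq_eq_dotProduct]
  simp

/-- The expected forgetting of tasks with optimal models `wstar`. -/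
noncomputable def expectedForgetting (T n p : ℕ) (σ : ℝ≥0) (wstar : Fin T → Param p) : ℝ :=
  1 / ((T : ℝ) - 1) * ∑ i : Fin T,
    (expectedError T (1 - n / p) (‖wstar i‖ ^ 2) (noiseError n p σ)
        (fun k => ‖wstar k - wstar i‖ ^ 2) T -
      expectedError T (1 - n / p) (‖wstar i‖ ^ 2) (noiseError n p σ)
        (fun k => ‖wstar k - wstar i‖ ^ 2) (i + 1))

lemma integrable_forgettingOfData_and_integral (σ : ℝ≥0) (h : n + 2 ≤ p)
    (wstar : Fin T → Param p) :
    Integrable (forgettingOfData (n := n) wstar) (dataLaw T n p σ) ∧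
    ∫ d, forgettingOfData wstar d ∂dataLaw T n p σ = expectedForgetting T n p σ wstar := by
  set m : Fin T → ℕ → (Fin T → TaskData n p) → ℝ := fun i t d =>
    (modelAfter (fun k => (wstar k).ofLp) t d - (wstar i).ofLp) ⬝ᵥ
      (modelAfter (fun k => (wstar k).ofLp) t d - (wstar i).ofLp) with hm
  have hae : forgettingOfData (n := n) wstar =ᵐ[dataLaw T n p σ]
      fun d => 1 / ((T : ℝ) - 1) * ∑ i : Fin T, (m i T d - m i (i + 1) d) := by
    filter_upwards [ae_trained_eq σ (by omega : n ≤ p) wstar] with d hd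
    rw [forgettingOfData, forgetting]
    simp only [hd, modelError_toLp]
    congr 1
    -- The last position may be included in the sum: there both errors are evaluated at the final
    -- iterate and cancel.
    refine Finset.sum_filter_of_ne fun i _ hi => ?_
    by_contra hlt
    have : (i : ℕ) + 1 = T := by have := i.2; omega
    exact hi (by rw [this, sub_self])
  have hmi : ∀ (i : Fin T) (t : ℕ), t ≤ T → Integrable (m i t) (dataLaw T n p σ) ∧
      ∫ d, m i t d ∂dataLaw T n p σ =
        expectedError T (1 - n / p) (‖wstar i‖ ^ 2) (noiseError n p σ)
          (fun k => ‖wstar k - wstar i‖ ^ 2) t := by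
    intro i t ht
    have := modelAfter_sq (n := n) σ h (fun k => (wstar k).ofLp) (wstar i).ofLp t ht
    refine ⟨this.1, this.2.trans ?_⟩
    simp only [norm_sq_eq_dotProduct, WithLp.ofLp_sub]
  have hi : ∀ i : Fin T, Integrable (fun d => m i T d - m i (i + 1) d) (dataLaw T n p σ) :=
    fun i => (hmi i T le_rfl).1.sub (hmi i (i + 1) i.2).1
  constructor
  · exact ((integrable_finsetSum _ fun i _ => hi i).const_mul _).congr hae.symm
  · rw [integral_congr_ae hae, integral_const_mul, integral_finsetSum _ fun i _ => hi i,
      expectedForgetting]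
    congr 1
    refine Finset.sum_congr rfl fun i _ => ?_
    rw [integral_sub (hmi i T le_rfl).1 (hmi i (i + 1) i.2).1, (hmi i T le_rfl).2,
      (hmi i (i + 1) i.2).2]

lemma IsGaussianData.integrable_forgettingInOrder_and_integral {Ω : Type*} [MeasurableSpace Ω]
    {μ : Measure Ω} [IsProbabilityMeasure μ] {σ : ℝ≥0}
    {X : Fin T → Ω → Matrix (Fin p) (Fin n) ℝ} {z : Fin T → Ω → Fin n → ℝ}
    (hdata : IsGaussianData μ σ X z) (h : n + 2 ≤ p) (wstar : Fin T → Param p)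
    (π : Equiv.Perm (Fin T)) :
    Integrable (fun ω => forgettingInOrder π wstar (fun k => X k ω) (fun k => z k ω)) μ ∧
    ∫ ω, forgettingInOrder π wstar (fun k => X k ω) (fun k => z k ω) ∂μ =
      expectedForgetting T n p σ (fun t => wstar (π t)) := by
  obtain ⟨h1, h2⟩ := integrable_forgettingOfData_and_integral (n := n) σ h fun t => wstar (π t)
  have hperm := measurePreserving_comp_perm (n := n) (p := p) σ π
  have hlaw := hdata.hasLaw
  have hae := hperm.measurable.comp_aemeasurable hlaw.aemeasurable
  have hmap : μ.map ((fun (d : Fin T → TaskData n p) k => d (π k)) ∘ taskData X z) =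
      dataLaw T n p σ := by
    rw [← AEMeasurable.map_map_of_aemeasurable hperm.measurable.aemeasurable hlaw.aemeasurable,
      hlaw.map_eq, hperm.map_eq]
  simp only [forgettingInOrder_eq]
  rw [← hmap] at h1 h2
  refine ⟨h1.comp_aemeasurable hae, ?_⟩
  rw [← h2, integral_map hae h1.aestronglyMeasurable]
  rfl

end Law

/-! ### Maximizing the discrepancy of a two-letter word -/

section Combinatorics

variable {T : ℕ}

/-- The sum of `r ^ (i - k)` over all pairs `k < i` of positions with different categories. -/
noncomputable def discrepancy (r : ℝ) (c : Fin T → Fin 2) : ℝ :=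
  ∑ i : Fin T, ∑ k : Fin T, if (k : ℕ) < i ∧ c k ≠ c i then r ^ ((i : ℕ) - k) else 0

/-- The alternating sequence of categories that starts with category `0`. -/
def alternating (T : ℕ) : Fin T → Fin 2 := fun t => if Even (t : ℕ) then 0 else 1

lemma discrepancy_of_isAlternating (r : ℝ) {c : Fin T → Fin 2} (hc : IsAlternating c) :
    discrepancy r c = discrepancy r (alternating T) := by
  obtain ⟨i, j, hij, h⟩ := hc
  have key : ∀ k l : Fin T, c k ≠ c l ↔ alternating T k ≠ alternating T l := by
    intro k l
    rw [h k, h l, alternating, alternating]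
    split_ifs <;> simp [hij, hij.symm]
  simp only [discrepancy, key]

/-- Up to exchanging letters, the alternating word has discrepancy `3r + r³`. It exceeds that of
`0011` by `2r(1 - r)` and that of `0110` by `r(1 - r)²`. -/
lemma discrepancy_four {r : ℝ} (h0 : 0 < r) (h1 : r < 1) (c : Fin 4 → Fin 2)
    (hc : ∑ i, (c i : ℕ) = 2) :
    IsAlternating c ∨ discrepancy r c < discrepancy r (alternating 4) := by
  have hr : ∀ m : ℕ, 0 < r ^ m * (1 - r) ^ 2 := fun m =>
    mul_pos (pow_pos h0 _) (pow_pos (sub_pos.2 h1) _)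
  have hl : ∀ m : ℕ, 0 < r ^ m * (1 - r) := fun m => mul_pos (pow_pos h0 _) (sub_pos.2 h1)
  have hcases : ∀ x : Fin 2, x = 0 ∨ x = 1 := by decide
  have ha : ∀ i : Fin 4, alternating 4 i = ![0, 1, 0, 1] i := by decide
  simp only [discrepancy, ha, Fin.sum_univ_four] at hc ⊢
  rcases hcases (c 0) with e0 | e0 <;> rcases hcases (c 1) with e1 | e1 <;>
    rcases hcases (c 2) with e2 | e2 <;> rcases hcases (c 3) with e3 | e3 <;>
    rw [e0, e1, e2, e3] at hc <;> try (exfalso; revert hc; decide)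
  all_goals first
    | (right
       simp only [e0, e1, e2, e3]
       simp
       linarith only [hr 1, hr 2, hr 3, hl 1, hl 2, hl 3])
    | exact Or.inl ⟨c 0, c 1, by rw [e0, e1]; decide, fun t => by
        fin_cases t <;> simp [e0, e1, e2, e3] <;> decide⟩

/-- Among the twenty balanced words, each gap to the alternating one is a nonnegative combination of
terms `r ^ m * (1 - r)` and `r ^ m * (1 - r) ^ 2`, found by linear arithmetic in the powers of `r`.
-/
lemma discrepancy_six {r : ℝ} (h0 : 0 < r) (h1 : r < 1) (c : Fin 6 → Fin 2)
    (hc : ∑ i, (c i : ℕ) = 3) :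
    IsAlternating c ∨ discrepancy r c < discrepancy r (alternating 6) := by
  have hr : ∀ m : ℕ, 0 < r ^ m * (1 - r) ^ 2 := fun m =>
    mul_pos (pow_pos h0 _) (pow_pos (sub_pos.2 h1) _)
  have hl : ∀ m : ℕ, 0 < r ^ m * (1 - r) := fun m => mul_pos (pow_pos h0 _) (sub_pos.2 h1)
  have hcases : ∀ x : Fin 2, x = 0 ∨ x = 1 := by decide
  have ha : ∀ i : Fin 6, alternating 6 i = ![0, 1, 0, 1, 0, 1] i := by decide
  simp only [discrepancy, ha, Fin.sum_univ_six] at hc ⊢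
  rcases hcases (c 0) with e0 | e0 <;> rcases hcases (c 1) with e1 | e1 <;>
    rcases hcases (c 2) with e2 | e2 <;> rcases hcases (c 3) with e3 | e3 <;>
    rcases hcases (c 4) with e4 | e4 <;> rcases hcases (c 5) with e5 | e5 <;>
    rw [e0, e1, e2, e3, e4, e5] at hc <;> try (exfalso; revert hc; decide)
  all_goals first
    | (right
       simp only [e0, e1, e2, e3, e4, e5]
       simp
       linarith only [hr 1, hr 2, hr 3, hr 4, hr 5, hl 1, hl 2, hl 3, hl 4, hl 5])
    | exact Or.inl ⟨c 0, c 1, by rw [e0, e1]; decide, fun t => by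
        fin_cases t <;> simp [e0, e1, e2, e3, e4, e5] <;> decide⟩

lemma exists_perm_comp_eq {α β : Type*} [Fintype α] [DecidableEq β] (f g : α → β)
    (h : ∀ b, (Finset.univ.filter fun a => f a = b).card =
      (Finset.univ.filter fun a => g a = b).card) :
    ∃ π : Equiv.Perm α, ∀ a, f (π a) = g a := by
  have e : ∀ b, Nonempty ({a // g a = b} ≃ {a // f a = b}) := fun b => by
    rw [← Fintype.card_eq, Fintype.card_subtype, Fintype.card_subtype, h]
  exact ⟨Equiv.ofFiberEquiv fun b => (e b).some, fun a => Equiv.ofFiberEquiv_map _ a⟩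

lemma card_filter_comp_perm (π : Equiv.Perm (Fin T)) (c : Fin T → Fin 2) (b : Fin 2) :
    (Finset.univ.filter fun k => c (π k) = b).card = (Finset.univ.filter fun k => c k = b).card :=
  Finset.card_bij (fun k _ => π k) (by simp) (fun _ _ _ _ h => π.injective h)
    fun k hk => ⟨π.symm k, by simpa using hk, by simp⟩

lemma card_filter_zero_add_one (c : Fin T → Fin 2) :
    (Finset.univ.filter fun k => c k = 0).card + (Finset.univ.filter fun k => c k = 1).card
      = T := by
  have h : ∀ k, c k = 1 ↔ ¬ c k = 0 := fun k => by omega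
  simp only [h, Finset.card_filter_add_card_filter_not]
  simp

lemma sum_val_eq_card (c : Fin T → Fin 2) :
    ∑ i, (c i : ℕ) = (Finset.univ.filter fun k => c k = 1).card := by
  rw [Finset.card_filter]
  refine Finset.sum_congr rfl fun i _ => ?_
  have : ∀ x : Fin 2, (x : ℕ) = if x = 1 then 1 else 0 := by decide
  exact this _

lemma card_filter_ne (c : Fin T → Fin 2) {M : ℕ}
    (hM : ∀ b, (Finset.univ.filter fun k => c k = b).card = M) (b : Fin 2) :
    (Finset.univ.filter fun k => b ≠ c k).card = M := by
  have h : ∀ b x : Fin 2, b ≠ x ↔ x = 1 - b := by decide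
  simp only [h b, hM]

lemma exists_expectedForgetting_eq (T n p : ℕ) (σ : ℝ≥0) (u : Fin 2 → Param p)
    (hnorm : ‖u 0‖ = ‖u 1‖) (M : ℕ) :
    ∃ A : ℝ, ∀ c : Fin T → Fin 2, (∀ b, (Finset.univ.filter fun k => c k = b).card = M) →
      expectedForgetting T n p σ (fun t => u (c t)) =
        A - 1 / ((T : ℝ) - 1) * ((n / p) * ‖u 0 - u 1‖ ^ 2) * discrepancy (1 - n / p) c := by
  set r : ℝ := 1 - n / p with hr
  set D : ℝ := ‖u 0 - u 1‖ ^ 2 with hD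
  set N := noiseError n p σ
  have hq : (n / p : ℝ) = 1 - r := by rw [hr]; ring
  have hu : ∀ b, ‖u b‖ = ‖u 0‖ := by
    intro b
    fin_cases b
    · rfl
    · exact hnorm.symm
  have huu : ∀ b b', ‖u b - u b'‖ ^ 2 = if b ≠ b' then D else 0 := by
    intro b b'
    fin_cases b <;> fin_cases b' <;> simp [hD, norm_sub_rev]
  -- `A` collects the start and noise terms and the final errors; in the latter each task `k` is
  -- counted by the `M` tasks of the other category, wherever they stand.
  refine ⟨1 / ((T : ℝ) - 1) * (∑ i : Fin T, ((r ^ T * ‖u 0‖ ^ 2 + N * ∑ k ∈ Finset.range T, r ^ k)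
    - (r ^ ((i : ℕ) + 1) * ‖u 0‖ ^ 2 + N * ∑ k ∈ Finset.range (i + 1), r ^ k))
    + ∑ k : Fin T, (1 - r) * r ^ (T - 1 - (k : ℕ)) * D * M), fun c hc => ?_⟩
  have hfinal : ∑ i : Fin T, ∑ k : Fin T,
      (if (k : ℕ) < T then (1 - r) * r ^ (T - 1 - (k : ℕ)) * (if c k ≠ c i then D else 0) else 0)
      = ∑ k : Fin T, (1 - r) * r ^ (T - 1 - (k : ℕ)) * D * M := by
    rw [Finset.sum_comm]
    refine Finset.sum_congr rfl fun k _ => ?_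
    simp only [k.2, if_true, ← Finset.mul_sum]
    rw [← Finset.sum_filter, Finset.sum_const, card_filter_ne c hc, nsmul_eq_mul]
    ring
  have hdisc : ∑ i : Fin T, ∑ k : Fin T,
      (if (k : ℕ) < (i : ℕ) + 1 then
        (1 - r) * r ^ ((i : ℕ) + 1 - 1 - (k : ℕ)) * (if c k ≠ c i then D else 0) else 0)
      = (1 - r) * D * discrepancy r c := by
    rw [discrepancy, Finset.mul_sum]
    refine Finset.sum_congr rfl fun i _ => ?_
    rw [Finset.mul_sum]
    refine Finset.sum_congr rfl fun k _ => ?_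
    by_cases hki : c k = c i
    · simp [hki]
    -- The error just after task `i` involves `k ≤ i`, but different categories force `k < i`,
    -- matching the definition of the discrepancy.
    · have hne : (k : ℕ) ≠ i := fun h => hki (by rw [Fin.ext h])
      by_cases hlt : (k : ℕ) < i
      · simp only [hlt, hki, Nat.lt_succ_of_lt hlt, ne_eq, not_false_eq_true, if_true, and_self,
          Nat.add_sub_cancel]
        ring
      · have : ¬ (k : ℕ) < (i : ℕ) + 1 := by omega
        simp [hlt, this]
  rw [expectedForgetting, hq, mul_assoc (1 / ((T : ℝ) - 1)), ← hdisc, ← hfinal, ← mul_sub]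
  congr 1
  rw [← Finset.sum_add_distrib, ← Finset.sum_sub_distrib]
  refine Finset.sum_congr rfl fun i _ => ?_
  simp only [expectedError, huu, hu, sub_sub_cancel]
  ring

lemma discrepancy_lt_or_isAlternating (hT : T = 4 ∨ T = 6) {r : ℝ} (h0 : 0 < r) (h1 : r < 1)
    (c : Fin T → Fin 2) {M : ℕ} (hM : ∀ b, (Finset.univ.filter fun k => c k = b).card = M) :
    IsAlternating c ∨ discrepancy r c < discrepancy r (alternating T) := by
  have h2 := card_filter_zero_add_one c
  have hs := sum_val_eq_card c
  rw [hM] at hs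
  rw [hM, hM] at h2
  rcases hT with rfl | rfl
  · exact discrepancy_four h0 h1 c (by omega)
  · exact discrepancy_six h0 h1 c (by omega)

lemma card_filter_alternating (hT : T = 4 ∨ T = 6) (b : Fin 2) :
    2 * (Finset.univ.filter fun k => alternating T k = b).card = T := by
  rcases hT with rfl | rfl <;> revert b <;> decide

end Combinatorics

end ContinualLearning

/-- Category `c` has optimal model `u c`, and task `k` belongs to category `cat k`. An order of the
tasks minimizes the expected forgetting if and only if it alternates between the categories. -/
theorem mainTheorem5 {Ω : Type*} [MeasurableSpace Ω] (μ : Measure Ω) [IsProbabilityMeasure μ]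
    (T n p : ℕ) (hT : T = 4 ∨ T = 6) (hn : 1 ≤ n) (hp : n + 2 ≤ p) (σ : ℝ≥0)
    (u : Fin 2 → ContinualLearning.Param p) (hu : u 0 ≠ u 1) (hnorm : ‖u 0‖ = ‖u 1‖)
    (cat : Fin T → Fin 2)
    (hcat : (Finset.univ.filter fun k => cat k = 0).card =
      (Finset.univ.filter fun k => cat k = 1).card)
    (X : Fin T → Ω → Matrix (Fin p) (Fin n) ℝ) (z : Fin T → Ω → Fin n → ℝ)
    (hdata : ContinualLearning.IsGaussianData μ σ X z) :
    (∀ π : Equiv.Perm (Fin T), Integrable (fun ω => ContinualLearning.forgettingInOrder π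
      (fun k => u (cat k)) (fun k => X k ω) (fun k => z k ω)) μ) ∧
    ∀ π : Equiv.Perm (Fin T),
      (∀ π' : Equiv.Perm (Fin T),
        ∫ ω, ContinualLearning.forgettingInOrder π
            (fun k => u (cat k)) (fun k => X k ω) (fun k => z k ω) ∂μ ≤
          ∫ ω, ContinualLearning.forgettingInOrder π'
            (fun k => u (cat k)) (fun k => X k ω) (fun k => z k ω) ∂μ) ↔
      ContinualLearning.IsAlternating (fun t => cat (π t)) := by
  have hint := fun π => hdata.integrable_forgettingInOrder_and_integral hp (fun k => u (cat k)) π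
  refine ⟨fun π => (hint π).1, fun π => ?_⟩
  simp only [fun π => (hint π).2]
  set M := (Finset.univ.filter fun k => cat k = 0).card with hM
  have hTM : 2 * M = T := by
    have := ContinualLearning.card_filter_zero_add_one cat
    omega
  have hcard : ∀ b, (Finset.univ.filter fun k => cat k = b).card = M := by
    intro b
    fin_cases b
    · rfl
    · exact hcat.symm
  have hcardπ : ∀ (π : Equiv.Perm (Fin T)) b,
      (Finset.univ.filter fun k => cat (π k) = b).card = M := fun π b =>
    (ContinualLearning.card_filter_comp_perm π cat b).trans (hcard b)
  obtain ⟨A, hA⟩ := ContinualLearning.exists_expectedForgetting_eq T n p σ u hnorm M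
  simp only [fun π : Equiv.Perm (Fin T) => hA (fun k => cat (π k)) (hcardπ π)]
  have hp0 : (0 : ℝ) < p := by exact_mod_cast (by omega : 0 < p)
  have hn0 : (0 : ℝ) < n := by exact_mod_cast hn
  have hr0 : (0 : ℝ) < 1 - n / p := by
    rw [sub_pos, div_lt_one hp0]
    exact_mod_cast (by omega : n < p)
  have hr1 : (1 : ℝ) - n / p < 1 := by
    have := div_pos hn0 hp0
    linarith
  have hB : 0 < 1 / ((T : ℝ) - 1) * ((n / p) * ‖u 0 - u 1‖ ^ 2) := by
    have hT1 : (0 : ℝ) < (T : ℝ) - 1 := by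
      rcases hT with rfl | rfl <;> norm_num
    have := norm_pos_iff.2 (sub_ne_zero.2 hu)
    positivity
  obtain ⟨π₀, hπ₀⟩ := ContinualLearning.exists_perm_comp_eq cat
      (ContinualLearning.alternating T) fun b => by
    have := ContinualLearning.card_filter_alternating hT b
    have := hcard b
    omega
  have hcase := fun π : Equiv.Perm (Fin T) =>
    ContinualLearning.discrepancy_lt_or_isAlternating hT hr0 hr1 (fun k => cat (π k)) (hcardπ π)
  constructor
  · intro hmin
    refine (hcase π).resolve_right fun hlt => ?_
    have := hmin π₀
    simp only [hπ₀] at this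
    have h2 := mul_lt_mul_of_pos_left hlt hB
    change A - _ * ContinualLearning.discrepancy _ (fun k => cat (π k)) ≤
      A - _ * ContinualLearning.discrepancy _ (ContinualLearning.alternating T)
      at this
    linarith
  · intro halt π'
    rw [ContinualLearning.discrepancy_of_isAlternating _ halt]
    have hle : ContinualLearning.discrepancy (1 - (n : ℝ) / p) (fun k => cat (π' k)) ≤
        ContinualLearning.discrepancy (1 - (n : ℝ) / p) (ContinualLearning.alternating T) := by
      rcases hcase π' with h | h
      · exact (ContinualLearning.discrepancy_of_isAlternating _ h).le
      · exact h.le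
    have := mul_le_mul_of_nonneg_left hle hB.le
    linarith
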